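/- Conventions. A regular category is a finitely complete category in which kernel pairs have coequalizers and regular epimorphisms are stable under pullback; it is exact if moreover every internal equivalence relation is a kernel pair. A Mal'tsev category is a finitely complete category in which every reflexive relation is an equivalence relation. A category has stable coequalizers of equivalence relations if every equivalence relation $R\rightrightarrows X$ has a coequalizer $q\colon X\to Q$ and, for every arrow $f\colon Y\to Q$, the pullback along $f$ of the diagram $R\rightrightarrows X\to Q$ is again a coequalizer diagram. A category $\mathcal X$ is a semi-localization of $\mathcal C$ if there is a fully faithful functor $U\colon\mathcal X\to\mathcal C$ with a left adjoint $L$ (with unit $\eta$) which is semi-left-exact: $L$ preserves every pullback in $\mathcal C$ of an arrow $Uf\colon UY\to ULQ$ along $\eta_Q\colon Q\to ULQ$. For a regular category $\mathcal X$, the exact completion $\mathcal X_{\mathrm{ex/reg}}$ has as objects the pairs $(X,R)$ with $R$ an equivalence relation on $X$, and as morphisms $(X,R)\to(Y,S)$ the relations $F$ from $X$ to $Y$ with $FR=F=SF$, $R\le F^\circ F$ and $FF^\circ\le S$, composed as relations; $\mathcal X$ embeds in it by $X\mapsto(X,1_X)$, sending a morphism to its graph. Theorem. For a category $\mathcal X$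 the following conditions are equivalent: (a) $\mathcal X$ is a regular Mal'tsev category and has stable coequalizers of equivalence relations; (b) $\mathcal X$ is a semi-localization of an exact Mal'tsev category $\mathcal C$; (c) $\mathcal X$ is a semi-localization of an exact Mal'tsev category $\mathcal C$, and the components of the unit of the reflection are regular epimorphisms; (d) $\mathcal X$ is a regular Mal'tsev category, and is a semi-localization (via the canonical embedding) of its exact completion $\mathcal X_{\mathrm{ex/reg}}$. Here, if the objects of $\mathcal X$ form a type in a universe $u$ and its hom-sets lie in a universe $v$, then $\mathcal C$ in (b) and (c) may be taken with objects and hom-sets in the universe $\max(u,v)$, while (b) implies (a) for $\mathcal C$ of any size. Moreover, if $\mathcal X$ is a regular Mal'tsev category, then $\mathcal X_{\mathrm{ex/reg}}$ is a Mal'tsev category. -/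

import Mathlib

open CategoryTheory CategoryTheory.Limits

universe v u v' u'

/-! ### Exact categories, Mal'tsev categories, stable coequalizers -/

/-- A (Barr-)exact category: a regular category in which every internal equivalence relation is
the kernel pair of some arrow. -/
structure IsExactCategory (C : Type u) [Category.{v} C] : Prop where
  regular : Regular C
  exists_isKernelPair : ∀ ⦃R X : C⦄ (p₁ p₂ : R ⟶ X), IsEquivalenceRelation p₁ p₂ →
    ∃ (Y : C) (f : X ⟶ Y), IsKernelPair f p₁ p₂

/-- A Mal'tsev category: a finitely complete category in which every reflexive relation is an
equivalence relation. -/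
structure IsMaltsevCategory (C : Type u) [Category.{v} C] : Prop where
  hasFiniteLimits : HasFiniteLimits C
  isEquivalenceRelation : ∀ ⦃R X : C⦄ (p₁ p₂ : R ⟶ X), ReflexiveRelation p₁ p₂ →
    IsEquivalenceRelation p₁ p₂

/-- Stable coequalizers of equivalence relations: every equivalence relation `p₁, p₂ : R ⟶ X` has
a coequalizer, and whenever `q : X ⟶ Q` is such a coequalizer, the pullback
`r₁, r₂ : S ⟶ X'`, `q' : X' ⟶ Y` of the whole diagram `R ⇉ X ⟶ Q` along any `f : Y ⟶ Q` is again
a coequalizer diagram. -/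
structure HasStableCoequalizersOfEquivalenceRelations (C : Type u) [Category.{v} C] : Prop where
  hasCoequalizer : ∀ ⦃R X : C⦄ (p₁ p₂ : R ⟶ X), IsEquivalenceRelation p₁ p₂ →
    HasCoequalizer p₁ p₂
  stable : ∀ ⦃R X Q : C⦄ (p₁ p₂ : R ⟶ X) (q : X ⟶ Q) (w : p₁ ≫ q = p₂ ≫ q),
    IsEquivalenceRelation p₁ p₂ → Nonempty (IsColimit (Cofork.ofπ q w)) →
    ∀ ⦃S X' Y : C⦄ (f : Y ⟶ Q) (q' : X' ⟶ Y) (x : X' ⟶ X) (t : S ⟶ Y) (s : S ⟶ R)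
      (r₁ r₂ : S ⟶ X'),
      IsPullback q' x f q → IsPullback t s f (p₁ ≫ q) →
      r₁ ≫ x = s ≫ p₁ → r₂ ≫ x = s ≫ p₂ →
      ∀ (w₁ : r₁ ≫ q' = t) (w₂ : r₂ ≫ q' = t),
        Nonempty (IsColimit (Cofork.ofπ q' (w₁.trans w₂.symm)))

/-! ### Semi-localizations -/

/-- The reflector `L` of a reflective (fully faithful) functor `U : X ⥤ C` is semi-left-exact: it
preserves all pullbacks of arrows `U f : U Y ⟶ U L Q` along the units `η_Q : Q ⟶ U L Q`. -/
def IsSemiLeftExactReflection {X : Type u} [Category.{v} X] {C : Type u'} [Category.{v'} C]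
    (U : X ⥤ C) [Reflective U] : Prop :=
  ∀ ⦃P Q : C⦄ ⦃Y : X⦄ (f : Y ⟶ (reflector U).obj Q) (a : P ⟶ U.obj Y) (b : P ⟶ Q),
    IsPullback a b (U.map f) ((reflectorAdjunction U).unit.app Q) →
    IsPullback ((reflector U).map a) ((reflector U).map b) ((reflector U).map (U.map f))
      ((reflector U).map ((reflectorAdjunction U).unit.app Q))

/-- `U` exhibits `X` as a semi-localization of `C`, i.e. as a full reflective subcategory with
semi-left-exact reflector. -/
def IsSemiLocalization {X : Type u} [Category.{v} X] {C : Type u'} [Category.{v'} C]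
    (U : X ⥤ C) : Prop :=
  ∃ _ : Reflective U, IsSemiLeftExactReflection U

/-- `U` exhibits `X` as a semi-localization of `C`, and the components of the unit of the
reflection are regular epimorphisms. -/
def IsSemiLocalizationWithRegularEpiUnits {X : Type u} [Category.{v} X] {C : Type u'}
    [Category.{v'} C] (U : X ⥤ C) : Prop :=
  ∃ _ : Reflective U, IsSemiLeftExactReflection U ∧
    ∀ Q : C, IsRegularEpi ((reflectorAdjunction U).unit.app Q)

/-! ### The calculus of relations in a regular category

A relation from `A` to `B` is a subobject of `A ⨯ B`. Composition is written in diagrammatic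
order. -/

namespace InternalRel

lemma mk_factors_iff_exists {X : Type u} [Category.{v} X] {A M T : X} (m : M ⟶ A) [Mono m] (g : T ⟶ A) :
    (Subobject.mk m).Factors g ↔ ∃ k : T ⟶ M, k ≫ m = g :=
  ⟨fun ⟨k, hk⟩ => ⟨k, hk⟩, fun ⟨k, hk⟩ => ⟨k, hk⟩⟩

variable {X : Type u} [Category.{v} X] [Regular X]

/-- The generalized elements `a` of `A` and `b` of `B` are related by `R`. -/
def Holds {A B T : X} (R : Subobject (A ⨯ B)) (a : T ⟶ A) (b : T ⟶ B) : Prop :=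
  R.Factors (prod.lift a b)

/-- A morphism seen as a relation, namely its graph. -/
noncomputable def graph {A B : X} (f : A ⟶ B) : Subobject (A ⨯ B) :=
  Subobject.mk (prod.lift (𝟙 A) f)

/-- The opposite relation. -/
noncomputable def op {A B : X} (R : Subobject (A ⨯ B)) : Subobject (B ⨯ A) :=
  Subobject.mk (R.arrow ≫ (prod.braiding A B).hom)

/-- Composition of relations `R` from `A` to `B` and `S` from `B` to `C`: the image in `A ⨯ C` of
the pullback `R ×_B S`. -/
noncomputable def comp {A B C : X} (R : Subobject (A ⨯ B)) (S : Subobject (B ⨯ C)) :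
    Subobject (A ⨯ C) :=
  imageSubobject (prod.lift
    (pullback.fst (R.arrow ≫ prod.snd) (S.arrow ≫ prod.fst) ≫ R.arrow ≫ prod.fst)
    (pullback.snd (R.arrow ≫ prod.snd) (S.arrow ≫ prod.fst) ≫ S.arrow ≫ prod.snd))

lemma Holds.precomp {A B T T' : X} {R : Subobject (A ⨯ B)} {a : T ⟶ A} {b : T ⟶ B}
    (h : Holds R a b) (e : T' ⟶ T) : Holds R (e ≫ a) (e ≫ b) := by
  have := Subobject.factors_of_factors_right e h
  rwa [prod.comp_lift] at this

lemma Holds.of_strongEpi {A B T T' : X} {R : Subobject (A ⨯ B)} {a : T ⟶ A} {b : T ⟶ B}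
    (e : T' ⟶ T) [StrongEpi e] (h : Holds R (e ≫ a) (e ≫ b)) : Holds R a b := by
  unfold Holds at h
  rw [← prod.comp_lift] at h
  have sq : CommSq (R.factorThru _ h) e R.arrow (prod.lift a b) := ⟨by simp⟩
  exact (Subobject.factors_iff _ _).2 ⟨sq.lift, sq.fac_right⟩

lemma holds_arrow {A B : X} (R : Subobject (A ⨯ B)) :
    Holds R (R.arrow ≫ prod.fst) (R.arrow ≫ prod.snd) := by
  have : prod.lift (R.arrow ≫ prod.fst) (R.arrow ≫ prod.snd) = R.arrow := by
    ext <;> simp only [prod.lift_fst, prod.lift_snd]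
  unfold Holds
  rw [this]
  exact Subobject.factors_self R

lemma le_iff {A B : X} {R S : Subobject (A ⨯ B)} :
    R ≤ S ↔ ∀ ⦃T : X⦄ (a : T ⟶ A) (b : T ⟶ B), Holds R a b → Holds S a b := by
  refine ⟨fun h T a b hR => Subobject.factors_of_le _ h hR, fun h => ?_⟩
  have := h _ _ (holds_arrow R)
  have e : prod.lift (R.arrow ≫ prod.fst) (R.arrow ≫ prod.snd) = R.arrow := by
    ext <;> simp only [prod.lift_fst, prod.lift_snd]
  unfold Holds at this
  rw [e] at this
  exact Subobject.le_of_factors this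

lemma holds_graph {A B T : X} (f : A ⟶ B) (a : T ⟶ A) (b : T ⟶ B) :
    Holds (graph f) a b ↔ a ≫ f = b := by
  unfold Holds graph
  rw [mk_factors_iff_exists]
  constructor
  · rintro ⟨g, hg⟩
    have h1 : g = a := by simpa [prod.lift_fst] using congrArg (· ≫ prod.fst) hg
    have h2 : g ≫ f = b := by simpa [prod.lift_snd] using congrArg (· ≫ prod.snd) hg
    rw [← h1, h2]
  · rintro rfl
    exact ⟨a, by simp⟩

lemma holds_op {A B T : X} (R : Subobject (A ⨯ B)) (b : T ⟶ B) (a : T ⟶ A) :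
    Holds (op R) b a ↔ Holds R a b := by
  unfold Holds op
  rw [mk_factors_iff_exists]
  constructor
  · rintro ⟨g, hg⟩
    have h : g ≫ R.arrow = prod.lift a b := by
      rw [← cancel_mono (prod.braiding A B).hom, Category.assoc, hg]
      simp [prod.lift_fst, prod.lift_snd]
    exact (Subobject.factors_iff _ _).2 ⟨g, h⟩
  · intro h
    refine ⟨R.factorThru _ h, ?_⟩
    simp [prod.lift_fst, prod.lift_snd]

lemma holds_comp {A B C T : X} (R : Subobject (A ⨯ B)) (S : Subobject (B ⨯ C))
    (a : T ⟶ A) (c : T ⟶ C) :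
    Holds (comp R S) a c ↔ ∃ (T' : X) (e : T' ⟶ T) (_ : StrongEpi e) (b : T' ⟶ B),
      Holds R (e ≫ a) b ∧ Holds S b (e ≫ c) := by
  constructor
  · intro h
    let k := prod.lift
      (pullback.fst (R.arrow ≫ prod.snd) (S.arrow ≫ prod.fst) ≫ R.arrow ≫ prod.fst)
      (pullback.snd (R.arrow ≫ prod.snd) (S.arrow ≫ prod.fst) ≫ S.arrow ≫ prod.snd)
    let m := (imageSubobject k).factorThru _ h
    have hm : m ≫ (imageSubobject k).arrow = prod.lift a c := Subobject.factorThru_arrow _ _ h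
    let p := factorThruImageSubobject k
    have hp : StrongEpi p := by
      dsimp only [p, factorThruImageSubobject]
      infer_instance
    have : IsRegularEpi p := inferInstance
    have hk : pullback.fst m p ≫ prod.lift a c = pullback.snd m p ≫ k := by
      rw [← hm, pullback.condition_assoc]
      exact congrArg _ (imageSubobject_arrow_comp k)
    have h1 := congrArg (· ≫ prod.fst) hk
    have h2 := congrArg (· ≫ prod.snd) hk
    simp only [k, prod.comp_lift, prod.lift_fst, prod.lift_snd] at h1 h2
    refine ⟨pullback m p, pullback.fst m p, inferInstance,
      pullback.snd m p ≫ pullback.fst _ _ ≫ R.arrow ≫ prod.snd, ?_, ?_⟩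
    · rw [h1]
      simpa only [Category.assoc] using
        (holds_arrow R).precomp (pullback.snd m p ≫ pullback.fst _ _)
    · rw [h2, pullback.condition]
      simpa only [Category.assoc] using
        (holds_arrow S).precomp (pullback.snd m p ≫ pullback.snd _ _)
  · rintro ⟨T', e, _, b, hR, hS⟩
    refine Holds.of_strongEpi e ?_
    let r := R.factorThru _ hR
    let s := S.factorThru _ hS
    have hr : r ≫ R.arrow = prod.lift (e ≫ a) b := Subobject.factorThru_arrow _ _ hR
    have hs : s ≫ S.arrow = prod.lift b (e ≫ c) := Subobject.factorThru_arrow _ _ hS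
    have w : r ≫ R.arrow ≫ prod.snd = s ≫ S.arrow ≫ prod.fst := by
      rw [reassoc_of% hr, reassoc_of% hs, prod.lift_fst, prod.lift_snd]
    refine (Subobject.factors_iff _ _).2
      ⟨pullback.lift r s w ≫ factorThruImageSubobject _, ?_⟩
    refine (Category.assoc _ _ _).trans ((congrArg _ (imageSubobject_arrow_comp _)).trans ?_)
    rw [prod.comp_lift, pullback.lift_fst_assoc, pullback.lift_snd_assoc, reassoc_of% hr,
      reassoc_of% hs, prod.lift_fst, prod.lift_snd]

lemma ext_holds {A B : X} {R S : Subobject (A ⨯ B)}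
    (h : ∀ ⦃T : X⦄ (a : T ⟶ A) (b : T ⟶ B), Holds R a b ↔ Holds S a b) : R = S :=
  le_antisymm (le_iff.2 fun _ a b => (h a b).1) (le_iff.2 fun _ a b => (h a b).2)

lemma comp_mono {A B C : X} {R R' : Subobject (A ⨯ B)} {S S' : Subobject (B ⨯ C)}
    (hR : R ≤ R') (hS : S ≤ S') : comp R S ≤ comp R' S' := by
  refine le_iff.2 fun T a c => ?_
  rw [holds_comp, holds_comp]
  rintro ⟨T', e, he, b, h1, h2⟩
  exact ⟨T', e, he, b, le_iff.1 hR _ _ h1, le_iff.1 hS _ _ h2⟩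

lemma comp_assoc {A B C D : X} (R : Subobject (A ⨯ B)) (S : Subobject (B ⨯ C))
    (Q : Subobject (C ⨯ D)) : comp (comp R S) Q = comp R (comp S Q) := by
  refine ext_holds fun T a d => ?_
  simp only [holds_comp]
  constructor
  · rintro ⟨T', e, he, c, ⟨T'', e', he', b, h1, h2⟩, h3⟩
    refine ⟨T'', e' ≫ e, strongEpi_comp _ _, b, by simpa using h1, T'', 𝟙 _, inferInstance,
      e' ≫ c, by simpa using h2, ?_⟩
    simpa using h3.precomp e'
  · rintro ⟨T', e, he, b, h1, T'', e', he', c, h2, h3⟩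
    refine ⟨T'', e' ≫ e, strongEpi_comp _ _, c, ⟨T'', 𝟙 _, inferInstance, e' ≫ b, ?_,
      by simpa using h2⟩, by simpa using h3⟩
    simpa using h1.precomp e'

lemma op_mono {A B : X} {R R' : Subobject (A ⨯ B)} (h : R ≤ R') : op R ≤ op R' :=
  le_iff.2 fun T a b => by
    rw [holds_op, holds_op]
    exact le_iff.1 h _ _

lemma op_op {A B : X} (R : Subobject (A ⨯ B)) : op (op R) = R :=
  ext_holds fun T a b => by rw [holds_op, holds_op]

lemma op_comp {A B C : X} (R : Subobject (A ⨯ B)) (S : Subobject (B ⨯ C)) :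
    op (comp R S) = comp (op S) (op R) := by
  refine ext_holds fun T a c => ?_
  simp only [holds_comp, holds_op]
  constructor <;> rintro ⟨T', e, he, b, h1, h2⟩ <;> exact ⟨T', e, he, b, h2, h1⟩

lemma graph_comp {A B C : X} (f : A ⟶ B) (g : B ⟶ C) :
    comp (graph f) (graph g) = graph (f ≫ g) := by
  refine ext_holds fun T a c => ?_
  simp only [holds_comp, holds_graph]
  constructor
  · rintro ⟨T', e, he, b, rfl, h⟩
    rw [← cancel_epi e, ← h]
    simp
  · rintro rfl
    exact ⟨T, 𝟙 _, inferInstance, a ≫ f, by simp, by simp⟩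

lemma graph_id_comp {A B : X} (R : Subobject (A ⨯ B)) : comp (graph (𝟙 A)) R = R := by
  refine ext_holds fun T a c => ?_
  simp only [holds_comp, holds_graph]
  constructor
  · rintro ⟨T', e, he, b, rfl, h⟩
    exact Holds.of_strongEpi e (by simpa using h)
  · intro h
    exact ⟨T, 𝟙 _, inferInstance, a, by simp, by simpa using h⟩

lemma op_graph_id (A : X) : op (graph (𝟙 A)) = graph (𝟙 A) := by
  refine ext_holds fun T a c => ?_
  simp only [holds_op, holds_graph, Category.comp_id]
  exact eq_comm

lemma comp_graph_id {A B : X} (R : Subobject (A ⨯ B)) : comp R (graph (𝟙 B)) = R := by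
  rw [← op_op (comp R _), op_comp, op_graph_id, graph_id_comp, op_op]

end InternalRel

/-! ### The exact completion of a regular category

The equivalence relations are split freely as idempotents in the bicategory of relations; the
category of maps of the result is the exact completion. -/

open InternalRel in
/-- The objects of the exact completion: an object of `X` with an equivalence relation on it. -/
structure ExReg (X : Type u) [Category.{v} X] [Regular X] where
  carrier : X
  rel : Subobject (carrier ⨯ carrier)
  refl : graph (𝟙 carrier) ≤ rel
  symm : rel ≤ op rel
  trans : comp rel rel ≤ rel

namespace ExReg

open InternalRel

variable {X : Type u} [Category.{v} X] [Regular X]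

lemma op_rel (A : ExReg X) : op A.rel = A.rel :=
  le_antisymm (by simpa only [op_op] using op_mono A.symm) A.symm

lemma rel_comp_rel (A : ExReg X) : comp A.rel A.rel = A.rel := by
  refine le_antisymm A.trans ?_
  conv_lhs => rw [← graph_id_comp A.rel]
  exact comp_mono A.refl le_rfl

/-- A morphism `(A, R) ⟶ (B, S)` in the free splitting of equivalence relations is a relation `F`
from `A` to `B` satisfying `left` and `right`, the identity of `(A, R)` being `R`. It is a map when
it is left adjoint to its opposite: `total` is the unit and `single_valued` the counit of this
adjunction. -/
@[ext]
structure Hom (A B : ExReg X) where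
  rel : Subobject (A.carrier ⨯ B.carrier)
  left : comp A.rel rel = rel
  right : comp rel B.rel = rel
  total : A.rel ≤ comp rel (op rel)
  single_valued : comp (op rel) rel ≤ B.rel

noncomputable instance : Category (ExReg X) where
  Hom := Hom
  id A :=
    { rel := A.rel
      left := A.rel_comp_rel
      right := A.rel_comp_rel
      total := by rw [A.op_rel, A.rel_comp_rel]
      single_valued := by rw [A.op_rel, A.rel_comp_rel] }
  comp {A B C} F G :=
    { rel := InternalRel.comp F.rel G.rel
      left := by rw [← comp_assoc, F.left]
      right := by rw [comp_assoc, G.right]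
      total := by
        rw [InternalRel.op_comp, comp_assoc, ← comp_assoc G.rel]
        refine F.total.trans ?_
        conv_lhs => rw [← F.right, comp_assoc]
        refine comp_mono le_rfl ?_
        rw [F.right]
        have h := comp_mono G.total (le_refl (op F.rel))
        exact h
      single_valued := by
        rw [InternalRel.op_comp, comp_assoc, ← comp_assoc (op F.rel)]
        refine (comp_mono le_rfl (comp_mono F.single_valued le_rfl)).trans ?_
        rw [G.left]
        exact G.single_valued }
  id_comp F := Hom.ext F.left
  comp_id F := Hom.ext F.right
  assoc F G H := Hom.ext (comp_assoc _ _ _)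

variable (X) in
/-- The canonical embedding of a regular category in its exact completion, sending an object `A`
to `A` with the equality relation, and a morphism to its graph. -/
noncomputable def embedding : X ⥤ ExReg X where
  obj A :=
    { carrier := A
      rel := graph (𝟙 A)
      refl := le_rfl
      symm := by rw [op_graph_id]
      trans := by rw [graph_comp, Category.comp_id] }
  map {A B} f :=
    { rel := graph f
      left := graph_id_comp _
      right := comp_graph_id _
      total := by
        refine le_iff.2 fun T a a' h => ?_
        replace h : a = a' := (Category.comp_id a).symm.trans ((holds_graph _ _ _).1 h)
        subst h
        rw [holds_comp]
        exact ⟨T, 𝟙 _, inferInstance, a ≫ f, by simp [holds_graph], by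
          simp [holds_graph, holds_op]⟩
      single_valued := by
        refine le_iff.2 fun T b b' h => ?_
        rw [holds_comp] at h
        obtain ⟨T', e, he, a, h1, h2⟩ := h
        rw [holds_op, holds_graph] at h1
        rw [holds_graph] at h2
        have : b = b' := by rw [← cancel_epi e, ← h1, ← h2]
        exact (holds_graph _ _ _).2 ((Category.comp_id b).trans this) }
  map_id _ := rfl
  map_comp f g := Hom.ext (graph_comp f g).symm

end ExReg

/-! The implications run (a) ⇒ (d) ⇒ (c) ⇒ (b) ⇒ (a). Computations in the exact completion use
generalized elements: a relation is tested by `Holds` on arrows out of an arbitrary `T`, and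
existence means existence after precomposing with a strong epimorphism, a cover of `T`. A morphism
of `ExReg X` is then a locally defined function, single-valued up to the given equivalence
relations.

Exactness of `ExReg X`: an equivalence relation on `(A, R)` spans a larger equivalence relation on
the carrier `A`, and `A` with that relation is the quotient (`exists_isKernelPair_surj`). For the
Mal'tsev property, a reflexive relation on `(A, R)` spans a reflexive relation on `A` in `X`; the
symmetry and transitivity available there lift back by joint monicity.

(a) ⇒ (d): morphisms from `(A, R)` to an embedded `Y` are the morphisms `A ⟶ Y` that coequalize `R`
(`exists_eq_toEmbedding`), so the coequalizer of `R` is the reflection. Pulling the unit back along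
`Y ⟶ L` gives the carrier `Y ×_L A` with the pulled back relation; by stability its coequalizer is
`Y`. The projection to `Y` is therefore again universal, which is semi-left-exactness
(`bijective_comp_map_of_isPullback`).

(d) ⇒ (c): a unit factors through the image of its underlying morphism, and universality splits the
inclusion of that image (`isRegularEpi_unit`).

(b) ⇒ (a): for an equivalence relation in `X`, the quotient is taken in `C` and reflected. The
coequalizer thus becomes a regular epimorphism of `C` followed by a universal arrow. The first
factor is stable by regularity, the second by semi-left-exactness
(`IsSemiLeftExactReflection.hasStableCoequalizers`). Applied to kernel pairs, stable coequalizers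
give regularity of `X`. -/

namespace InternalRel

/-! ### Relations tested on generalized elements -/

variable {X : Type u} [Category.{v} X] [Regular X]

lemma holds_inf {A B T : X} (R S : Subobject (A ⨯ B)) (a : T ⟶ A) (b : T ⟶ B) :
    Holds (R ⊓ S) a b ↔ Holds R a b ∧ Holds S a b :=
  Subobject.inf_factors _

lemma holds_top {A B T : X} (a : T ⟶ A) (b : T ⟶ B) : Holds (⊤ : Subobject (A ⨯ B)) a b :=
  Subobject.top_factors _

/-- The inverse image of a relation along a pair of morphisms. -/
noncomputable def pull {A A' B B' : X} (f : A' ⟶ A) (g : B' ⟶ B) (R : Subobject (A ⨯ B)) :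
    Subobject (A' ⨯ B') :=
  (Subobject.pullback (prod.map f g)).obj R

lemma holds_pull {A A' B B' T : X} (f : A' ⟶ A) (g : B' ⟶ B) (R : Subobject (A ⨯ B))
    (a : T ⟶ A') (b : T ⟶ B') : Holds (pull f g R) a b ↔ Holds R (a ≫ f) (b ≫ g) := by
  have h : prod.lift (a ≫ f) (b ≫ g) = prod.lift a b ≫ prod.map f g := by
    ext <;> simp [prod.lift_fst, prod.lift_snd]
  have sq := Subobject.isPullback (prod.map f g) R
  unfold Holds pull
  rw [h, Subobject.factors_iff, Subobject.factors_iff]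
  constructor
  · rintro ⟨k, hk⟩
    refine ⟨k ≫ Subobject.pullbackπ (prod.map f g) R, ?_⟩
    have hk' : k ≫ Subobject.arrow _ = prod.lift a b := hk
    refine (Category.assoc _ _ _).trans ?_
    refine (congrArg (k ≫ ·) sq.w).trans ?_
    refine (Category.assoc _ _ _).symm.trans ?_
    exact congrArg (· ≫ _) hk'
  · rintro ⟨k, hk⟩
    exact ⟨sq.lift k (prod.lift a b) hk, sq.lift_snd _ _ _⟩

lemma holds_iff_exists {A B T : X} {R : Subobject (A ⨯ B)} {a : T ⟶ A} {b : T ⟶ B} :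
    Holds R a b ↔ ∃ k : T ⟶ (R : X), k ≫ R.arrow ≫ prod.fst = a ∧ k ≫ R.arrow ≫ prod.snd = b := by
  constructor
  · intro h
    have hk : R.factorThru _ h ≫ R.arrow = prod.lift a b := Subobject.factorThru_arrow _ _ h
    refine ⟨R.factorThru _ h, ?_, ?_⟩
    · exact ((Category.assoc _ _ _).symm.trans (congrArg (· ≫ _) hk)).trans (prod.lift_fst _ _)
    · exact ((Category.assoc _ _ _).symm.trans (congrArg (· ≫ _) hk)).trans (prod.lift_snd _ _)
  · rintro ⟨k, rfl, rfl⟩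
    exact (holds_arrow R).precomp k

instance jointlyMono₂_arrow {A B : X} (R : Subobject (A ⨯ B)) :
    JointlyMono₂ (R.arrow ≫ prod.fst) (R.arrow ≫ prod.snd) where
  right_cancellation Y f g h₁ h₂ := by
    rw [← cancel_mono R.arrow]
    ext
    · simpa using h₁
    · simpa using h₂

/-- A morphism compatible with the kernel pair of a strong epimorphism descends along it. -/
lemma exists_desc {A B T : X} (e : T ⟶ A) [StrongEpi e] (b : T ⟶ B)
    (h : ∀ ⦃W : X⦄ (g₁ g₂ : W ⟶ T), g₁ ≫ e = g₂ ≫ e → g₁ ≫ b = g₂ ≫ b) :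
    ∃ f : A ⟶ B, e ≫ f = b := by
  have : IsRegularEpi e := inferInstance
  let r := IsRegularEpi.getStruct e
  obtain ⟨f, hf⟩ := Cofork.IsColimit.desc' r.isColimit b (h _ _ r.w)
  exact ⟨f, hf⟩

end InternalRel

/-! ### Morphisms of the exact completion as local functions -/

namespace ExReg

open InternalRel

variable {X : Type u} [Category.{v} X] [Regular X]

/-- Generalized elements of `A.carrier` identified by the equivalence relation of `A`. -/
def Eqv (A : ExReg X) {T : X} (a a' : T ⟶ A.carrier) : Prop := Holds A.rel a a'

/-- Generalized elements related by a morphism of the exact completion. -/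
def Rel {A B : ExReg X} (F : A ⟶ B) {T : X} (a : T ⟶ A.carrier) (b : T ⟶ B.carrier) : Prop :=
  Holds (Hom.rel F) a b

section Eqv

variable {A : ExReg X} {T T' : X}

lemma Eqv.refl (a : T ⟶ A.carrier) : Eqv A a a :=
  le_iff.1 A.refl a a ((holds_graph _ _ _).2 (Category.comp_id a))

lemma Eqv.of_eq {a a' : T ⟶ A.carrier} (h : a = a') : Eqv A a a' := h ▸ Eqv.refl a

lemma Eqv.symm {a a' : T ⟶ A.carrier} (h : Eqv A a a') : Eqv A a' a :=
  (holds_op _ _ _).1 (le_iff.1 A.symm a a' h)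

lemma Eqv.trans {a b c : T ⟶ A.carrier} (h : Eqv A a b) (h' : Eqv A b c) : Eqv A a c :=
  le_iff.1 A.trans a c ((holds_comp _ _ _ _).2
    ⟨T, 𝟙 _, inferInstance, b, by simpa using! h, by simpa using! h'⟩)

lemma Eqv.precomp {a a' : T ⟶ A.carrier} (h : Eqv A a a') (e : T' ⟶ T) :
    Eqv A (e ≫ a) (e ≫ a') :=
  Holds.precomp h e

lemma Eqv.of_strongEpi {a a' : T ⟶ A.carrier} (e : T' ⟶ T) [StrongEpi e]
    (h : Eqv A (e ≫ a) (e ≫ a')) : Eqv A a a' :=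
  Holds.of_strongEpi e h

end Eqv

section Rel

variable {A B C : ExReg X} {T T' : X}

lemma Rel.precomp {F : A ⟶ B} {a : T ⟶ A.carrier} {b : T ⟶ B.carrier} (h : Rel F a b)
    (e : T' ⟶ T) : Rel F (e ≫ a) (e ≫ b) :=
  Holds.precomp h e

lemma Rel.of_strongEpi {F : A ⟶ B} {a : T ⟶ A.carrier} {b : T ⟶ B.carrier} (e : T' ⟶ T)
    [StrongEpi e] (h : Rel F (e ≫ a) (e ≫ b)) : Rel F a b :=
  Holds.of_strongEpi e h

lemma Rel.left {F : A ⟶ B} {a a' : T ⟶ A.carrier} {b : T ⟶ B.carrier} (h : Rel F a b)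
    (h' : Eqv A a' a) : Rel F a' b := by
  have : Holds (InternalRel.comp A.rel (Hom.rel F)) a' b := (holds_comp _ _ _ _).2
    ⟨T, 𝟙 _, inferInstance, a, by simpa using! h', by simpa using! h⟩
  rwa [Hom.left F] at this

lemma Rel.right {F : A ⟶ B} {a : T ⟶ A.carrier} {b b' : T ⟶ B.carrier} (h : Rel F a b)
    (h' : Eqv B b b') : Rel F a b' := by
  have : Holds (InternalRel.comp (Hom.rel F) B.rel) a b' := (holds_comp _ _ _ _).2
    ⟨T, 𝟙 _, inferInstance, b, by simpa using! h, by simpa using! h'⟩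
  rwa [Hom.right F] at this

/-- This is the unit `R ≤ F F°` read at a reflexive pair. Composition of relations is an image, so a
value exists only on a cover. -/
lemma Rel.exists (F : A ⟶ B) (a : T ⟶ A.carrier) :
    ∃ (T' : X) (e : T' ⟶ T) (_ : StrongEpi e) (b : T' ⟶ B.carrier), Rel F (e ≫ a) b := by
  obtain ⟨T', e, he, b, h, -⟩ :=
    (holds_comp _ _ _ _).1 (le_iff.1 (Hom.total F) a a (Eqv.refl a))
  exact ⟨T', e, he, b, h⟩

lemma Rel.unique {F : A ⟶ B} {a : T ⟶ A.carrier} {b b' : T ⟶ B.carrier} (h : Rel F a b)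
    (h' : Rel F a b') : Eqv B b b' :=
  le_iff.1 (Hom.single_valued F) b b' ((holds_comp _ _ _ _).2
    ⟨T, 𝟙 _, inferInstance, a, (holds_op _ _ _).2 (by simpa using! h), by simpa using! h'⟩)

lemma rel_id {a a' : T ⟶ A.carrier} : Rel (𝟙 A) a a' ↔ Eqv A a a' := Iff.rfl

lemma rel_comp {F : A ⟶ B} {G : B ⟶ C} {a : T ⟶ A.carrier} {c : T ⟶ C.carrier} :
    Rel (F ≫ G) a c ↔ ∃ (T' : X) (e : T' ⟶ T) (_ : StrongEpi e) (b : T' ⟶ B.carrier),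
      Rel F (e ≫ a) b ∧ Rel G b (e ≫ c) :=
  holds_comp _ _ _ _

lemma Rel.comp {F : A ⟶ B} {G : B ⟶ C} {a : T ⟶ A.carrier} {b : T ⟶ B.carrier}
    {c : T ⟶ C.carrier} (h : Rel F a b) (h' : Rel G b c) : Rel (F ≫ G) a c :=
  rel_comp.2 ⟨T, 𝟙 _, inferInstance, b, by simpa using! h, by simpa using! h'⟩

/-- The hidden intermediate value agrees with any known value of `F` up to `Eqv`, so it can be
replaced by that value. This is how commutative diagrams are used elementwise. -/
lemma Rel.of_comp {F : A ⟶ B} {G : B ⟶ C} {a : T ⟶ A.carrier} {b : T ⟶ B.carrier}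
    {c : T ⟶ C.carrier} (h : Rel (F ≫ G) a c) (h' : Rel F a b) : Rel G b c := by
  obtain ⟨T', e, he, b', h1, h2⟩ := rel_comp.1 h
  exact Rel.of_strongEpi e (h2.left ((h'.precomp e).unique h1))

/-- One inclusion suffices: maps are total and single-valued, so an inclusion between two of them is
an equality. -/
lemma hom_ext' {F G : A ⟶ B}
    (h : ∀ ⦃T : X⦄ (a : T ⟶ A.carrier) (b : T ⟶ B.carrier), Rel F a b → Rel G a b) : F = G := by
  refine Hom.ext (ext_holds fun T a b => ⟨fun h' => h a b h', fun h' => ?_⟩)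
  obtain ⟨T', e, he, b', h1⟩ := Rel.exists F a
  refine Rel.of_strongEpi e (h1.right ?_)
  exact (h _ _ h1).unique (Rel.precomp h' e)

/-- Elementwise construction of morphisms of the exact completion. -/
noncomputable def homMk (R : Subobject (A.carrier ⨯ B.carrier))
    (compat : ∀ ⦃T : X⦄ (a a' : T ⟶ A.carrier) (b b' : T ⟶ B.carrier),
      Eqv A a a' → Holds R a' b' → Eqv B b' b → Holds R a b)
    (total : ∀ ⦃T : X⦄ (a : T ⟶ A.carrier),
      ∃ (T' : X) (e : T' ⟶ T) (_ : StrongEpi e) (b : T' ⟶ B.carrier), Holds R (e ≫ a) b)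
    (unique : ∀ ⦃T : X⦄ (a : T ⟶ A.carrier) (b b' : T ⟶ B.carrier),
      Holds R a b → Holds R a b' → Eqv B b b') : A ⟶ B where
  rel := R
  left := by
    refine ext_holds fun T a b => ⟨fun h => ?_, fun h => ?_⟩
    · obtain ⟨T', e, he, a', h1, h2⟩ := (holds_comp _ _ _ _).1 h
      exact Holds.of_strongEpi e (compat _ _ _ _ h1 h2 (Eqv.refl _))
    · exact (holds_comp _ _ _ _).2 ⟨T, 𝟙 _, inferInstance, a,
        by simpa using! Eqv.refl a, by simpa using h⟩
  right := by
    refine ext_holds fun T a b => ⟨fun h => ?_, fun h => ?_⟩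
    · obtain ⟨T', e, he, a', h1, h2⟩ := (holds_comp _ _ _ _).1 h
      exact Holds.of_strongEpi e (compat _ _ _ _ (Eqv.refl _) h1 h2)
    · exact (holds_comp _ _ _ _).2 ⟨T, 𝟙 _, inferInstance, b,
        by simpa using h, by simpa using! Eqv.refl b⟩
  total := by
    refine le_iff.2 fun T a a' h => ?_
    obtain ⟨T', e, he, b, h1⟩ := total a
    exact (holds_comp _ _ _ _).2 ⟨T', e, he, b, h1, (holds_op _ _ _).2
      (compat _ _ _ _ (Eqv.precomp h e).symm h1 (Eqv.refl _))⟩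
  single_valued := by
    refine le_iff.2 fun T b b' h => ?_
    obtain ⟨T', e, he, a, h1, h2⟩ := (holds_comp _ _ _ _).1 h
    exact Eqv.of_strongEpi e (unique a _ _ ((holds_op _ _ _).1 h1) h2)

/-- The morphism of the exact completion induced by a morphism compatible with the equivalence
relations. -/
noncomputable def homOfMap (f : A.carrier ⟶ B.carrier)
    (hf : ∀ ⦃T : X⦄ (a a' : T ⟶ A.carrier), Eqv A a a' → Eqv B (a ≫ f) (a' ≫ f)) : A ⟶ B :=
  homMk (pull f (𝟙 _) B.rel)
    (fun T a a' b b' h1 h2 h3 => by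
      rw [holds_pull, Category.comp_id] at h2 ⊢
      exact ((hf _ _ h1).trans h2).trans h3)
    (fun T a => ⟨T, 𝟙 _, inferInstance, a ≫ f, by
      rw [holds_pull, Category.comp_id, Category.id_comp]
      exact Eqv.refl _⟩)
    (fun T a b b' h1 h2 => by
      rw [holds_pull, Category.comp_id] at h1 h2
      exact (Eqv.symm h1).trans h2)

lemma rel_homOfMap {f : A.carrier ⟶ B.carrier} {hf} {a : T ⟶ A.carrier} {b : T ⟶ B.carrier} :
    Rel (homOfMap f hf) a b ↔ Eqv B (a ≫ f) b := by
  refine (holds_pull _ _ _ _ _).trans ?_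
  rw [Category.comp_id]
  rfl

lemma rel_homOfMap_self (f : A.carrier ⟶ B.carrier) {hf} (a : T ⟶ A.carrier) :
    Rel (homOfMap f hf) a (a ≫ f) :=
  rel_homOfMap.2 (Eqv.refl _)

end Rel

section Embedding

variable {A B : X} {T : X}

lemma eqv_embedding {a a' : T ⟶ A} : Eqv ((embedding X).obj A) a a' ↔ a = a' := by
  refine (holds_graph _ _ _).trans ?_
  exact ⟨fun h => (Category.comp_id a).symm.trans h, fun h => (Category.comp_id a).trans h⟩

lemma rel_embedding_map {f : A ⟶ B} {a : T ⟶ A} {b : T ⟶ B} :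
    Rel ((embedding X).map f) a b ↔ a ≫ f = b :=
  holds_graph _ _ _

/-- A generalized element as a morphism of the exact completion. -/
noncomputable def point (C : ExReg X) (c : T ⟶ C.carrier) : (embedding X).obj T ⟶ C :=
  homOfMap (A := (embedding X).obj T) c fun _ _ _ h => Eqv.of_eq (by rw [eqv_embedding.1 h])

lemma rel_point {C : ExReg X} {c : T ⟶ C.carrier} {T' : X} {t : T' ⟶ T} {c' : T' ⟶ C.carrier} :
    Rel (point C c) t c' ↔ Eqv C (t ≫ c) c' :=
  rel_homOfMap

lemma rel_point_self {C : ExReg X} (c : T ⟶ C.carrier) {T' : X} (t : T' ⟶ T) :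
    Rel (point C c) t (t ≫ c) :=
  rel_point.2 (Eqv.refl _)

/-- The dictionary between elements and arrows: points play the role of representables, and
universal properties are tested on them. -/
lemma rel_of_comp_point {C D : ExReg X} {F : C ⟶ D} {c : T ⟶ C.carrier} {d : T ⟶ D.carrier} :
    point C c ≫ F = point D d ↔ Rel F c d := by
  constructor
  · intro h
    have h1 : Rel (point D d) (𝟙 T) d := rel_point.2 (Eqv.of_eq (Category.id_comp d))
    have h2 : Rel (point C c) (𝟙 T) c := rel_point.2 (Eqv.of_eq (Category.id_comp c))
    rw [← h] at h1
    exact h1.of_comp h2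
  · intro h
    symm
    refine hom_ext' fun T' t d' h' => ?_
    exact Rel.comp (b := t ≫ c) (rel_point.2 (Eqv.refl _)) ((h.precomp t).right (rel_point.1 h'))

lemma point_eq_point {C : ExReg X} {c c' : T ⟶ C.carrier} :
    point C c = point C c' ↔ Eqv C c c' := by
  rw [← rel_id, ← rel_of_comp_point, Category.comp_id]

lemma exists_rel_of_embedding {C : ExReg X} (F : (embedding X).obj T ⟶ C) :
    ∃ (T' : X) (e : T' ⟶ T) (_ : StrongEpi e) (c : T' ⟶ C.carrier), Rel F e c := by
  obtain ⟨T', e, he, c, h⟩ := Rel.exists F (𝟙 T : T ⟶ ((embedding X).obj T).carrier)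
  have h2 : e ≫ (𝟙 T : T ⟶ ((embedding X).obj T).carrier) = e := Category.comp_id (Y := T) e
  exact ⟨T', e, he, c, h2 ▸ h⟩

instance : (embedding X).Faithful where
  map_injective {A B f g} h := by
    have h1 : Rel ((embedding X).map f) (𝟙 A) f := rel_embedding_map.2 (Category.id_comp f)
    rw [h] at h1
    exact (rel_embedding_map.1 h1).symm.trans (Category.id_comp g)

/-- A morphism has a value on some cover `e` of the domain. Single-valuedness in an object with the
equality relation is true equality, so the value is compatible with the kernel pair of `e` and
descends along it. -/
instance : (embedding X).Full where
  map_surjective {A B} F := by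
    obtain ⟨T', e, he, b, h⟩ := exists_rel_of_embedding F
    obtain ⟨f, hf⟩ := exists_desc (B := B) e b fun W g₁ g₂ hg => by
      have h1 : Rel F (g₂ ≫ e) (g₁ ≫ b) := hg ▸ h.precomp g₁
      exact eqv_embedding.1 (h1.unique (h.precomp g₂))
    refine ⟨f, hom_ext' fun T (a : T ⟶ A) (b' : T ⟶ B) h' => ?_⟩
    have h' : a ≫ f = b' := rel_embedding_map.1 h'
    subst h'
    have h2 : Rel F (𝟙 A : A ⟶ A) f := by
      refine Rel.of_strongEpi e ?_
      have h3 : e ≫ (𝟙 A : A ⟶ ((embedding X).obj A).carrier) = e := Category.comp_id (Y := A) e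
      exact h3.symm ▸ hf.symm ▸ h
    have h3 : a ≫ (𝟙 A : A ⟶ ((embedding X).obj A).carrier) = a := Category.comp_id (Y := A) a
    exact h3.subst (motive := fun z => Rel F z (a ≫ f)) (h2.precomp a)

end Embedding

/-- An elementwise form of joint monicity of a pair of morphisms. -/
def InjPair {P A B : ExReg X} (p : P ⟶ A) (q : P ⟶ B) : Prop :=
  ∀ ⦃T : X⦄ (t t' : T ⟶ P.carrier) (a : T ⟶ A.carrier) (b : T ⟶ B.carrier),
    Rel p t a → Rel p t' a → Rel q t b → Rel q t' b → Eqv P t t'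

/-! ### Jointly monic pairs and lifting through them -/

section InjPair

variable {P A B W : ExReg X} {p : P ⟶ A} {q : P ⟶ B}

lemma InjPair.hom_ext (h : InjPair p q) {F G : W ⟶ P} (h₁ : F ≫ p = G ≫ p)
    (h₂ : F ≫ q = G ≫ q) : F = G := by
  refine hom_ext' fun T w t hF => ?_
  obtain ⟨T₁, e₁, _, a, ha⟩ := Rel.exists p t
  obtain ⟨T₂, e₂, _, b, hb⟩ := Rel.exists q (e₁ ≫ t)
  obtain ⟨T₃, e₃, _, t', ht'⟩ := Rel.exists G (e₂ ≫ e₁ ≫ w)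
  have hF' := ((hF.precomp e₁).precomp e₂).precomp e₃
  have ha' := (ha.precomp e₂).precomp e₃
  have hb' := hb.precomp e₃
  have ha'' : Rel p t' (e₃ ≫ e₂ ≫ a) := Rel.of_comp (h₁ ▸ hF'.comp ha') ht'
  have hb'' : Rel q t' (e₃ ≫ b) := Rel.of_comp (h₂ ▸ hF'.comp hb') ht'
  have key := ht'.right (h _ _ _ _ ha'' ha' hb'' hb')
  exact Rel.of_strongEpi e₁ (Rel.of_strongEpi e₂ (Rel.of_strongEpi e₃ key))

lemma InjPair.of_jointlyMono₂ (h : JointlyMono₂ p q) : InjPair p q := by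
  intro T t t' a b h1 h2 h3 h4
  rw [← point_eq_point]
  apply h.right_cancellation
  · rw [rel_of_comp_point.2 h1, rel_of_comp_point.2 h2]
  · rw [rel_of_comp_point.2 h3, rel_of_comp_point.2 h4]

/-- The lift relates `w` to `t` when `p t = F w` and `q t = G w` locally. The hypothesis `hFG` makes
this relation total, and joint monicity makes it single-valued. -/
lemma InjPair.exists_lift (h : InjPair p q) (F : W ⟶ A) (G : W ⟶ B)
    (hFG : ∀ ⦃T : X⦄ (w : T ⟶ W.carrier) (a : T ⟶ A.carrier) (b : T ⟶ B.carrier),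
      Rel F w a → Rel G w b → ∃ (T' : X) (e : T' ⟶ T) (_ : StrongEpi e) (t : T' ⟶ P.carrier),
        Rel p t (e ≫ a) ∧ Rel q t (e ≫ b)) :
    ∃ H : W ⟶ P, H ≫ p = F ∧ H ≫ q = G := by
  let R : Subobject (W.carrier ⨯ P.carrier) :=
    InternalRel.comp (Hom.rel F) (op (Hom.rel p)) ⊓ InternalRel.comp (Hom.rel G) (op (Hom.rel q))
  have hR : ∀ ⦃T : X⦄ (w : T ⟶ W.carrier) (t : T ⟶ P.carrier), Holds R w t ↔
      (∃ (T' : X) (e : T' ⟶ T) (_ : StrongEpi e) (a : T' ⟶ A.carrier),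
        Rel F (e ≫ w) a ∧ Rel p (e ≫ t) a) ∧
      (∃ (T' : X) (e : T' ⟶ T) (_ : StrongEpi e) (b : T' ⟶ B.carrier),
        Rel G (e ≫ w) b ∧ Rel q (e ≫ t) b) := by
    intro T w t
    simp only [R, holds_inf, holds_comp, holds_op]
    rfl
  let H : W ⟶ P := homMk R
    (fun T w w' t t' h1 h2 h3 => by
      rw [hR] at h2 ⊢
      obtain ⟨⟨T₁, e₁, _, a, ha, ha'⟩, T₂, e₂, _, b, hb, hb'⟩ := h2
      exact ⟨⟨T₁, e₁, ‹_›, a, ha.left (h1.precomp _), ha'.left (h3.symm.precomp _)⟩,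
        T₂, e₂, ‹_›, b, hb.left (h1.precomp _), hb'.left (h3.symm.precomp _)⟩)
    (fun T w => by
      obtain ⟨T₁, e₁, _, a, ha⟩ := Rel.exists F w
      obtain ⟨T₂, e₂, _, b, hb⟩ := Rel.exists G (e₁ ≫ w)
      obtain ⟨T₃, e₃, _, t, ht₁, ht₂⟩ := hFG _ _ _ (ha.precomp e₂) hb
      refine ⟨T₃, (e₃ ≫ e₂) ≫ e₁, strongEpi_comp _ _, t, (hR _ _).2
        ⟨⟨T₃, 𝟙 _, inferInstance, e₃ ≫ e₂ ≫ a, ?_, ?_⟩,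
          ⟨T₃, 𝟙 _, inferInstance, e₃ ≫ b, ?_, ?_⟩⟩⟩
      · simpa using (ha.precomp e₂).precomp e₃
      · simpa using ht₁
      · simpa using hb.precomp e₃
      · simpa using ht₂)
    (fun T w t t' h1 h2 => by
      rw [hR] at h1 h2
      obtain ⟨⟨T₁, e₁, _, a, ha₁, ha₂⟩, T₂, e₂, _, b, hb₁, hb₂⟩ := h1
      obtain ⟨⟨T₃, e₃, _, a', ha₁', ha₂'⟩, T₄, e₄, _, b', hb₁', hb₂'⟩ := h2
      -- The four witnesses live on different covers of `T`; `x` refines the two for `p`, `y` the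
      -- two for `q`, and their pullback refines all four.
      let x := pullback.fst e₁ e₃ ≫ e₁
      let y := pullback.fst e₂ e₄ ≫ e₂
      have hx : x = pullback.snd e₁ e₃ ≫ e₃ := pullback.condition
      have hy : y = pullback.snd e₂ e₄ ≫ e₄ := pullback.condition
      have : StrongEpi x := strongEpi_comp _ _
      have : StrongEpi y := strongEpi_comp _ _
      have : StrongEpi (pullback.fst x y ≫ x) := strongEpi_comp _ _
      refine Eqv.of_strongEpi (pullback.fst x y ≫ x) (h _ _
        (pullback.fst x y ≫ pullback.fst e₁ e₃ ≫ a)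
        (pullback.snd x y ≫ pullback.fst e₂ e₄ ≫ b) ?_ ?_ ?_ ?_)
      · simpa [x] using (ha₂.precomp (pullback.fst e₁ e₃)).precomp (pullback.fst x y)
      · rw [Category.assoc]
        refine Rel.precomp ?_ _
        rw [hx, Category.assoc]
        refine (ha₂'.precomp (pullback.snd e₁ e₃)).right ?_
        have h1 := ha₁'.precomp (pullback.snd e₁ e₃)
        rw [← Category.assoc, ← hx] at h1
        have h2 := ha₁.precomp (pullback.fst e₁ e₃)
        rw [← Category.assoc] at h2
        exact h1.unique h2
      · rw [pullback.condition]
        rw [Category.assoc]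
        refine Rel.precomp ?_ _
        simpa [y] using (hb₂.precomp (pullback.fst e₂ e₄))
      · rw [pullback.condition]
        rw [Category.assoc]
        refine Rel.precomp ?_ _
        rw [hy, Category.assoc]
        refine (hb₂'.precomp (pullback.snd e₂ e₄)).right ?_
        have h1 := hb₁'.precomp (pullback.snd e₂ e₄)
        rw [← Category.assoc, ← hy] at h1
        have h2 := hb₁.precomp (pullback.fst e₂ e₄)
        rw [← Category.assoc] at h2
        exact h1.unique h2)
  refine ⟨H, hom_ext' fun T w a h' => ?_, hom_ext' fun T w a h' => ?_⟩
  · obtain ⟨T', e, _, t, h1, h2⟩ := rel_comp.1 h'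
    obtain ⟨⟨T₁, e₁, _, a', ha', ha''⟩, -⟩ := (hR _ _).1 h1
    exact Rel.of_strongEpi e (Rel.of_strongEpi e₁ (ha'.right (ha''.unique (h2.precomp e₁))))
  · obtain ⟨T', e, _, t, h1, h2⟩ := rel_comp.1 h'
    obtain ⟨-, ⟨T₁, e₁, _, a', ha', ha''⟩⟩ := (hR _ _).1 h1
    exact Rel.of_strongEpi e (Rel.of_strongEpi e₁ (ha'.right (ha''.unique (h2.precomp e₁))))

end InjPair

/-! ### Elementwise recognition of pullbacks -/

section Pullback

variable {P A B C : ExReg X} {p : P ⟶ A} {q : P ⟶ B} {F : A ⟶ C} {G : B ⟶ C}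

lemma isPullback_of_injPair (w : p ≫ F = q ≫ G) (h : InjPair p q)
    (hex : ∀ ⦃T : X⦄ (a : T ⟶ A.carrier) (b : T ⟶ B.carrier) (c : T ⟶ C.carrier),
      Rel F a c → Rel G b c → ∃ (T' : X) (e : T' ⟶ T) (_ : StrongEpi e) (t : T' ⟶ P.carrier),
        Rel p t (e ≫ a) ∧ Rel q t (e ≫ b)) :
    IsPullback p q F G := by
  have hlift (s : PullbackCone F G) : ∃ H : s.pt ⟶ P, H ≫ p = s.fst ∧ H ≫ q = s.snd := by
    refine h.exists_lift s.fst s.snd fun T x a b ha hb => ?_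
    obtain ⟨T₁, e₁, _, c, hc⟩ := Rel.exists F a
    have h1 : Rel G (e₁ ≫ b) c := Rel.of_comp (F := s.snd) (a := e₁ ≫ x)
      (s.condition ▸ (ha.precomp e₁).comp hc) (hb.precomp e₁)
    obtain ⟨T₂, e₂, _, t, h2, h3⟩ := hex _ _ _ hc h1
    exact ⟨T₂, e₂ ≫ e₁, strongEpi_comp _ _, t, by simpa using h2, by simpa using h3⟩
  choose l hl₁ hl₂ using hlift
  exact ⟨⟨w⟩, ⟨PullbackCone.IsLimit.mk w l hl₁ hl₂ fun s m h₁ h₂ =>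
    h.hom_ext (h₁.trans (hl₁ s).symm) (h₂.trans (hl₂ s).symm)⟩⟩

/-- The elements `a` and `b` are points with equal composites, so they induce an arrow from the
embedded `T` to the pullback; a local value of that arrow is the required element. -/
lemma exists_of_isPullback (h : IsPullback p q F G) {T : X} {a : T ⟶ A.carrier}
    {b : T ⟶ B.carrier} {c : T ⟶ C.carrier} (ha : Rel F a c) (hb : Rel G b c) :
    ∃ (T' : X) (e : T' ⟶ T) (_ : StrongEpi e) (t : T' ⟶ P.carrier),
        Rel p t (e ≫ a) ∧ Rel q t (e ≫ b) := by
  have hw : point A a ≫ F = point B b ≫ G := by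
    rw [rel_of_comp_point.2 ha, rel_of_comp_point.2 hb]
  obtain ⟨T', e, he, t, ht⟩ := exists_rel_of_embedding (h.lift _ _ hw)
  refine ⟨T', e, he, t, ?_, ?_⟩
  · refine Rel.of_comp (F := h.lift _ _ hw) (a := e) ?_ ht
    rw [h.lift_fst]
    exact rel_point.2 (Eqv.refl _)
  · refine Rel.of_comp (F := h.lift _ _ hw) (a := e) ?_ ht
    rw [h.lift_snd]
    exact rel_point.2 (Eqv.refl _)

end Pullback

end ExReg

/-! ### Internal equivalence relations in terms of elements -/

namespace InternalRel

variable {X : Type u} [Category.{v} X] [Regular X]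

/-- Each axiom at its generic element (the identity of `A`, the relation itself, the object of
composable pairs) yields the corresponding structural morphism. -/
lemma isEquivalenceRelation_arrow {A : X} {R : Subobject (A ⨯ A)}
    (refl : ∀ ⦃T : X⦄ (a : T ⟶ A), Holds R a a)
    (symm : ∀ ⦃T : X⦄ (a b : T ⟶ A), Holds R a b → Holds R b a)
    (trans : ∀ ⦃T : X⦄ (a b c : T ⟶ A), Holds R a b → Holds R b c → Holds R a c) :
    IsEquivalenceRelation (R.arrow ≫ prod.fst) (R.arrow ≫ prod.snd) := by
  obtain ⟨r, hr₁, hr₂⟩ := holds_iff_exists.1 (refl (𝟙 A))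
  obtain ⟨s, hs₁, hs₂⟩ := holds_iff_exists.1 (symm _ _ (holds_arrow R))
  let f := pullback.fst (R.arrow ≫ prod.snd) (R.arrow ≫ prod.fst)
  let g := pullback.snd (R.arrow ≫ prod.snd) (R.arrow ≫ prod.fst)
  have hfg : f ≫ R.arrow ≫ prod.snd = g ≫ R.arrow ≫ prod.fst := pullback.condition
  obtain ⟨t, ht₁, ht₂⟩ := holds_iff_exists.1
    (trans (f ≫ R.arrow ≫ prod.fst) (f ≫ R.arrow ≫ prod.snd) (g ≫ R.arrow ≫ prod.snd)
      ((holds_arrow R).precomp f) (hfg ▸ (holds_arrow R).precomp g))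
  exact ⟨⟨{ jointlyMono₂_arrow R with
    r := r, reflexivity₁ := hr₁, reflexivity₂ := hr₂
    s := s, symmetry₁ := hs₁, symmetry₂ := hs₂
    c := pullback.cone _ _, isLimit := pullback.isLimit _ _
    t := t, transitivity₁ := ht₁, transitivity₂ := ht₂ }⟩⟩

section

variable {A : X} {R : Subobject (A ⨯ A)}

lemma holds_symm_of_isEquivalenceRelation
    (h : IsEquivalenceRelation (R.arrow ≫ prod.fst) (R.arrow ≫ prod.snd)) {T : X} {a b : T ⟶ A}
    (hab : Holds R a b) : Holds R b a := by
  obtain ⟨e⟩ := h.nonempty_equivalenceRelation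
  obtain ⟨k, rfl, rfl⟩ := holds_iff_exists.1 hab
  refine holds_iff_exists.2 ⟨k ≫ e.s, ?_, ?_⟩ <;> rw [Category.assoc]
  · rw [e.symmetry₁]
  · rw [e.symmetry₂]

lemma holds_trans_of_isEquivalenceRelation
    (h : IsEquivalenceRelation (R.arrow ≫ prod.fst) (R.arrow ≫ prod.snd)) {T : X} {a b c : T ⟶ A}
    (hab : Holds R a b) (hbc : Holds R b c) : Holds R a c := by
  obtain ⟨e⟩ := h.nonempty_equivalenceRelation
  obtain ⟨k, hk₁, hk₂⟩ := holds_iff_exists.1 hab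
  obtain ⟨l, hl₁, hl₂⟩ := holds_iff_exists.1 hbc
  obtain ⟨m, hm₁, hm₂⟩ := PullbackCone.IsLimit.lift' e.isLimit k l (hk₂.trans hl₁.symm)
  refine holds_iff_exists.2 ⟨m ≫ e.t, ?_, ?_⟩ <;> rw [Category.assoc]
  · rw [e.transitivity₁, reassoc_of% hm₁, hk₁]
  · rw [e.transitivity₂, reassoc_of% hm₂, hl₂]

end

end InternalRel

/-! ### Finite limits in the exact completion -/

namespace ExReg

open InternalRel

variable {X : Type u} [Category.{v} X] [Regular X]

/-- Elementwise construction of objects of the exact completion. -/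
noncomputable def objMk (A : X) (R : Subobject (A ⨯ A))
    (refl : ∀ ⦃T : X⦄ (a : T ⟶ A), Holds R a a)
    (symm : ∀ ⦃T : X⦄ (a b : T ⟶ A), Holds R a b → Holds R b a)
    (trans : ∀ ⦃T : X⦄ (a b c : T ⟶ A), Holds R a b → Holds R b c → Holds R a c) : ExReg X where
  carrier := A
  rel := R
  refl := le_iff.2 fun T a b h => by
    have h : a = b := (Category.comp_id a).symm.trans ((holds_graph _ _ _).1 h)
    exact h ▸ refl a
  symm := le_iff.2 fun T a b h => (holds_op _ _ _).2 (symm _ _ h)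
  trans := le_iff.2 fun T a c h => by
    obtain ⟨T', e, he, b, h1, h2⟩ := (holds_comp _ _ _ _).1 h
    exact Holds.of_strongEpi e (trans _ _ _ h1 h2)

instance : HasTerminal (ExReg X) := by
  let Z : ExReg X := objMk (⊤_ X) ⊤ (fun _ _ => holds_top _ _) (fun _ _ _ _ => holds_top _ _)
    (fun _ _ _ _ _ _ => holds_top _ _)
  have hZ {T : X} (a b : T ⟶ Z.carrier) : Eqv Z a b := holds_top _ _
  refine IsTerminal.hasTerminal (IsTerminal.ofUniqueHom (Y := Z)
    (fun W => homOfMap (terminal.from _) fun _ _ _ _ => hZ _ _) fun W F => ?_)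
  exact hom_ext' fun T w z _ => rel_homOfMap.2 (hZ _ _)

section Pullback

variable {A B C : ExReg X} (F : A ⟶ C) (G : B ⟶ C)

/-- The object of pairs of elements with a common image. -/
noncomputable def pairs : Subobject (A.carrier ⨯ B.carrier) :=
  InternalRel.comp (Hom.rel F) (op (Hom.rel G))

variable {F G} in
lemma holds_pairs {T : X} {a : T ⟶ A.carrier} {b : T ⟶ B.carrier} :
    Holds (pairs F G) a b ↔ ∃ (T' : X) (e : T' ⟶ T) (_ : StrongEpi e) (c : T' ⟶ C.carrier),
      Rel F (e ≫ a) c ∧ Rel G (e ≫ b) c := by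
  simp only [pairs, holds_comp, holds_op]
  rfl

/-- The first projection from the object of pairs. -/
noncomputable abbrev pairsFst : (pairs F G : X) ⟶ A.carrier := (pairs F G).arrow ≫ prod.fst

/-- The second projection from the object of pairs. -/
noncomputable abbrev pairsSnd : (pairs F G : X) ⟶ B.carrier := (pairs F G).arrow ≫ prod.snd

/-- The pullback in the exact completion. -/
noncomputable def pb : ExReg X :=
  objMk (pairs F G : X)
    (pull (pairsFst F G) (pairsFst F G) A.rel ⊓ pull (pairsSnd F G) (pairsSnd F G) B.rel)
    (fun _ a => by
      rw [holds_inf, holds_pull, holds_pull]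
      exact ⟨Eqv.refl _, Eqv.refl _⟩)
    (fun _ a b h => by
      rw [holds_inf, holds_pull, holds_pull] at h ⊢
      exact ⟨Eqv.symm h.1, Eqv.symm h.2⟩)
    (fun _ a b c h h' => by
      rw [holds_inf, holds_pull, holds_pull] at h h' ⊢
      exact ⟨Eqv.trans h.1 h'.1, Eqv.trans h.2 h'.2⟩)

lemma eqv_pb {T : X} {t t' : T ⟶ (pairs F G : X)} : Eqv (pb F G) t t' ↔
    Eqv A (t ≫ pairsFst F G) (t' ≫ pairsFst F G) ∧
      Eqv B (t ≫ pairsSnd F G) (t' ≫ pairsSnd F G) := (holds_inf _ _ _ _).trans (and_congr (holds_pull _ _ _ _ _) (holds_pull _ _ _ _ _))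

/-- The first projection of the pullback. -/
noncomputable def pbFst : pb F G ⟶ A :=
  homOfMap (A := pb F G) (pairsFst F G) fun _ _ _ h => ((eqv_pb F G).1 h).1

/-- The second projection of the pullback. -/
noncomputable def pbSnd : pb F G ⟶ B :=
  homOfMap (A := pb F G) (pairsSnd F G) fun _ _ _ h => ((eqv_pb F G).1 h).2

/-- The relation on `pb F G` identifies pairs exactly when both components agree, hence joint
monicity; elements with a common image form an element of `pairs` without passing to a cover. -/
lemma isPullback_pb : IsPullback (pbFst F G) (pbSnd F G) F G := by
  refine isPullback_of_injPair (hom_ext' fun T (t : T ⟶ (pairs F G : X)) c h => ?_)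
    (fun T (t t' : T ⟶ (pairs F G : X)) a b h1 h2 h3 h4 => ?_) (fun T a b c h1 h2 => ?_)
  · have ht := (holds_arrow (pairs F G)).precomp t
    obtain ⟨T', e, he, c', h1, h2⟩ := holds_pairs.1 ht
    refine Rel.of_strongEpi e ?_
    refine Rel.comp (F := pbSnd F G) (b := e ≫ t ≫ pairsSnd F G) ?_ (h2.right ?_)
    · exact (rel_homOfMap_self (A := pb F G) _ t).precomp e
    · have h3 : Rel F _ _ := Rel.of_comp h (rel_homOfMap_self (A := pb F G) _ t)
      exact h1.unique (h3.precomp e)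
  · exact (eqv_pb F G).2 ⟨(rel_homOfMap.1 h1).trans (rel_homOfMap.1 h2).symm,
      (rel_homOfMap.1 h3).trans (rel_homOfMap.1 h4).symm⟩
  · have hab : Holds (pairs F G) a b := holds_pairs.2 ⟨T, 𝟙 _, inferInstance, c,
      by simpa using h1, by simpa using h2⟩
    obtain ⟨k, rfl, rfl⟩ := holds_iff_exists.1 hab
    refine ⟨T, 𝟙 _, inferInstance, k, ?_, ?_⟩ <;> rw [Category.id_comp]
    · exact rel_homOfMap_self (A := pb F G) _ k
    · exact rel_homOfMap_self (A := pb F G) _ k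

end Pullback

instance : HasPullbacks (ExReg X) := by
  have {A B C : ExReg X} {F : A ⟶ C} {G : B ⟶ C} : HasLimit (cospan F G) :=
    (isPullback_pb F G).hasPullback
  exact hasPullbacks_of_hasLimit_cospan _

instance : HasFiniteLimits (ExReg X) :=
  hasFiniteLimits_of_hasTerminal_and_pullbacks

/-- Elementwise surjectivity of a morphism of the exact completion. -/
def Surj {A B : ExReg X} (F : A ⟶ B) : Prop :=
  ∀ ⦃T : X⦄ (b : T ⟶ B.carrier), ∃ (T' : X) (e : T' ⟶ T) (_ : StrongEpi e) (a : T' ⟶ A.carrier),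
    Rel F a (e ≫ b)

/-! ### Regular epimorphisms and images in the exact completion -/

section Surj

variable {A B C : ExReg X}

lemma Surj.of_comp {F : A ⟶ B} {G : B ⟶ C} (h : Surj (F ≫ G)) : Surj G := by
  intro T c
  obtain ⟨T', e, _, a, ha⟩ := h c
  obtain ⟨T'', e', _, b, -, hb⟩ := rel_comp.1 ha
  exact ⟨T'', e' ≫ e, strongEpi_comp _ _, b, by simpa using hb⟩

lemma surj_of_isIso (F : A ⟶ B) [IsIso F] : Surj F := by
  refine Surj.of_comp (F := inv F) ?_
  rw [IsIso.inv_hom_id]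
  exact fun T b => ⟨T, 𝟙 _, inferInstance, b, rel_id.2 (Eqv.of_eq (Category.id_comp b).symm)⟩

/-- `F` coequalizes the two projections from `pairs F F`, taken with the equality relation: this
pair already detects all elements with a common image. A competing cofork descends along the
relation that sends `b` to the value at any local preimage of `b`. -/
lemma Surj.isRegularEpi {F : A ⟶ B} (hF : Surj F) : IsRegularEpi F := by
  have w : point A (pairsFst F F) ≫ F = point A (pairsSnd F F) ≫ F := by
    obtain ⟨T, e, _, c, h1, h2⟩ := holds_pairs.1 (holds_arrow (pairs F F))
    refine (hom_ext' fun W t c' h => ?_)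
    have h := Rel.of_comp h (rel_point_self _ t)
    obtain ⟨t, rfl⟩ : ∃ t' : W ⟶ (pairs F F : X), t' = t := ⟨t, rfl⟩
    have : StrongEpi (pullback.snd e t) := inferInstance
    refine Rel.comp (rel_point_self _ t) ?_
    refine Rel.of_strongEpi (pullback.snd e t) ?_
    have h3 := h2.precomp (pullback.fst e t)
    have h4 := h1.precomp (pullback.fst e t)
    rw [← Category.assoc, pullback.condition, Category.assoc] at h3 h4
    exact h3.right (h4.unique (h.precomp _))
  have huniq {C : ExReg X} (H : A ⟶ C) (hH : point A (pairsFst F F) ≫ H =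
      point A (pairsSnd F F) ≫ H) {T : X} {a a' : T ⟶ A.carrier} {b : T ⟶ B.carrier}
      {c c' : T ⟶ C.carrier} (h1 : Rel F a b) (h2 : Rel F a' b) (h3 : Rel H a c)
      (h4 : Rel H a' c') : Eqv C c c' := by
    have hab : Holds (pairs F F) a a' := holds_pairs.2 ⟨T, 𝟙 _, inferInstance, b,
      by simpa using h1, by simpa using h2⟩
    obtain ⟨k, rfl, rfl⟩ := holds_iff_exists.1 hab
    have h5 := (rel_point_self _ k).comp h3
    have h6 := (rel_point_self _ k).comp h4
    exact Rel.unique h5 (hH ▸ h6)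
  have hdesc (s : Cofork (point A (pairsFst F F)) (point A (pairsSnd F F))) :
      ∃ K : B ⟶ s.pt, F ≫ K = s.π := by
    have hR {T : X} {b : T ⟶ B.carrier} {c : T ⟶ s.pt.carrier} :
        Holds (InternalRel.comp (op (Hom.rel F)) (Hom.rel s.π)) b c ↔
        ∃ (T' : X) (e : T' ⟶ T) (_ : StrongEpi e) (a : T' ⟶ A.carrier),
          Rel F a (e ≫ b) ∧ Rel s.π a (e ≫ c) := by
      simp only [holds_comp, holds_op]
      rfl
    let K : B ⟶ s.pt := homMk (InternalRel.comp (op (Hom.rel F)) (Hom.rel s.π))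
      (fun T b b' c c' h1 h2 h3 => by
        rw [hR] at h2 ⊢
        obtain ⟨T', e, _, a, h4, h5⟩ := h2
        exact ⟨T', e, ‹_›, a, h4.right (h1.symm.precomp e), h5.right (h3.precomp e)⟩)
      (fun T b => by
        obtain ⟨T', e, _, a, ha⟩ := hF b
        obtain ⟨T'', e', _, c, hc⟩ := Rel.exists s.π a
        exact ⟨T'', e' ≫ e, strongEpi_comp _ _, c, hR.2 ⟨T'', 𝟙 _, inferInstance, e' ≫ a,
          by simpa using ha.precomp e', by simpa using hc⟩⟩)
      (fun T b c c' h1 h2 => by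
        rw [hR] at h1 h2
        obtain ⟨T₁, e₁, _, a₁, h3, h4⟩ := h1
        obtain ⟨T₂, e₂, _, a₂, h5, h6⟩ := h2
        have hc : pullback.fst e₁ e₂ ≫ e₁ = pullback.snd e₁ e₂ ≫ e₂ := pullback.condition
        have : StrongEpi (pullback.fst e₁ e₂ ≫ e₁) := strongEpi_comp _ _
        refine Eqv.of_strongEpi (pullback.fst e₁ e₂ ≫ e₁) ?_
        have h3' := h3.precomp (pullback.fst e₁ e₂)
        have h4' := h4.precomp (pullback.fst e₁ e₂)
        have h5' := h5.precomp (pullback.snd e₁ e₂)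
        have h6' := h6.precomp (pullback.snd e₁ e₂)
        rw [← Category.assoc] at h3' h4' h5' h6'
        rw [← hc] at h5' h6'
        exact huniq s.π s.condition h3' h5' h4' h6')
    refine ⟨K, (hom_ext' fun T a c h => ?_).symm⟩
    obtain ⟨T', e, _, b, hb⟩ := Rel.exists F a
    refine Rel.of_strongEpi e (hb.comp (G := K) ?_)
    exact hR.2 ⟨T', 𝟙 _, inferInstance, e ≫ a, by simpa using hb, by simpa using h.precomp e⟩
  choose K hK using hdesc
  refine ⟨⟨⟨_, _, _, w, Cofork.IsColimit.mk _ K hK fun s m hm => ?_⟩⟩⟩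
  refine hom_ext' fun T b c h => ?_
  obtain ⟨T', e, _, a, ha⟩ := hF b
  have hm : F ≫ m = F ≫ K s := hm.trans (hK s).symm
  exact Rel.of_strongEpi e (Rel.of_comp (hm ▸ ha.comp (h.precomp e)) ha)

/-- The coimage of a morphism. -/
noncomputable def coim (F : A ⟶ B) : ExReg X :=
  objMk A.carrier (pairs F F)
    (fun T a => by
      obtain ⟨T', e, he, b, hb⟩ := Rel.exists F a
      exact holds_pairs.2 ⟨T', e, he, b, hb, hb⟩)
    (fun T a b h => by
      obtain ⟨T', e, he, b, hb, hb'⟩ := holds_pairs.1 h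
      exact holds_pairs.2 ⟨T', e, he, b, hb', hb⟩)
    (fun T a b c h h' => by
      obtain ⟨T₁, e₁, _, b₁, hb₁, hb₁'⟩ := holds_pairs.1 h
      obtain ⟨T₂, e₂, _, b₂, hb₂, hb₂'⟩ := holds_pairs.1 h'
      have hc : pullback.fst e₁ e₂ ≫ e₁ = pullback.snd e₁ e₂ ≫ e₂ := pullback.condition
      refine holds_pairs.2 ⟨_, pullback.fst e₁ e₂ ≫ e₁, strongEpi_comp _ _,
        pullback.fst e₁ e₂ ≫ b₁, by simpa using hb₁.precomp (pullback.fst e₁ e₂), ?_⟩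
      have h1 := hb₁'.precomp (pullback.fst e₁ e₂)
      have h2 := hb₂.precomp (pullback.snd e₁ e₂)
      have h3 := hb₂'.precomp (pullback.snd e₁ e₂)
      rw [← Category.assoc] at h1 h2 h3
      rw [← hc] at h2 h3
      exact h3.right (h2.unique h1))

lemma eqv_coim {F : A ⟶ B} {T : X} {a a' : T ⟶ A.carrier} {b b' : T ⟶ B.carrier}
    (h : Rel F a b) (h' : Rel F a' b') : Eqv (coim F) a a' ↔ Eqv B b b' := by
  refine holds_pairs.trans ⟨?_, fun hb => ?_⟩
  · rintro ⟨T', e, _, c, h1, h2⟩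
    exact Eqv.of_strongEpi e ((h1.unique (h.precomp e)).symm.trans (h2.unique (h'.precomp e)))
  · exact ⟨T, 𝟙 _, inferInstance, b', by simpa using h.right hb, by simpa using h'⟩

/-- The projection to the coimage. -/
noncomputable def coimProj (F : A ⟶ B) : A ⟶ coim F :=
  homOfMap (B := coim F) (𝟙 A.carrier) fun T a a' h => by
    obtain ⟨T', e, _, b, hb⟩ := Rel.exists F a
    refine Eqv.of_strongEpi e ((eqv_coim (b := b) (b' := b) ?_ ?_).2 (Eqv.refl b))
    · exact (Category.comp_id a).symm ▸ hb
    · exact (Category.comp_id a').symm ▸ hb.left (h.symm.precomp e)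

/-- The comparison of the coimage with the codomain. -/
noncomputable def coimDesc (F : A ⟶ B) : coim F ⟶ B :=
  homMk (A := coim F) (Hom.rel (A := A) F)
    (fun T a a' b b' h1 h2 h3 => by
      obtain ⟨T', e, _, c, hc⟩ := Rel.exists F a
      have h4 := (eqv_coim hc (Rel.precomp h2 e)).1 (Eqv.precomp h1 e)
      exact Rel.of_strongEpi e (hc.right (h4.trans (h3.precomp e))))
    (fun _ a => Rel.exists F a) (fun T a b b' h1 h2 => Rel.unique (F := F) h1 h2)

lemma rel_coimDesc {F : A ⟶ B} {T : X} {a : T ⟶ A.carrier} {b : T ⟶ B.carrier} :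
    Rel (coimDesc F) a b ↔ Rel F a b :=
  Iff.rfl

lemma coimProj_coimDesc (F : A ⟶ B) : coimProj F ≫ coimDesc F = F := by
  refine (hom_ext' fun T a b h => ?_).symm
  have h1 : Rel (coimProj F) a (B := coim F) a :=
    rel_homOfMap.2 (Eqv.of_eq (A := coim F) (Category.comp_id a))
  exact h1.comp (rel_coimDesc.2 h)

instance (F : A ⟶ B) : Mono (coimDesc F) where
  right_cancellation {W} G H h := by
    refine InjPair.hom_ext (p := coimDesc F) (q := coimDesc F) ?_ h h
    exact fun T t t' a b h1 h2 _ _ => (eqv_coim (F := F) (rel_coimDesc.1 h1) (rel_coimDesc.1 h2)).2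
      (Eqv.refl a)

/-- The mono part of the coimage factorization is invertible when `F` is a strong epimorphism, and
it has the same underlying relation as `F`. -/
lemma surj_of_strongEpi (F : A ⟶ B) [StrongEpi F] : Surj F := by
  have : StrongEpi (coimProj F ≫ coimDesc F) := by
    rw [coimProj_coimDesc]
    infer_instance
  have : StrongEpi (coimDesc F) := strongEpi_of_strongEpi (coimProj F) _
  have : IsIso (coimDesc F) := isIso_of_mono_of_strongEpi _
  intro T b
  obtain ⟨T', e, he, a, ha⟩ := surj_of_isIso (coimDesc F) b
  exact ⟨T', e, he, a, rel_coimDesc.1 ha⟩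

lemma surj_of_isRegularEpi (F : A ⟶ B) [IsRegularEpi F] : Surj F :=
  surj_of_strongEpi F

lemma Surj.of_isPullback {D : ExReg X} {P : A ⟶ B} {Q : A ⟶ C} {F : B ⟶ D} {G : C ⟶ D}
    (h : IsPullback P Q F G) (hF : Surj F) : Surj Q := by
  intro T c
  obtain ⟨T₁, e₁, _, d, hd⟩ := Rel.exists G c
  obtain ⟨T₂, e₂, _, b, hb⟩ := hF d
  obtain ⟨T₃, e₃, _, a, -, ha⟩ := exists_of_isPullback h hb (hd.precomp e₂)
  have : StrongEpi (e₂ ≫ e₁) := strongEpi_comp _ _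
  exact ⟨T₃, e₃ ≫ e₂ ≫ e₁, strongEpi_comp _ _, a, by simpa using ha⟩

end Surj

/-! ### Quotients, exactness and the Mal'tsev property -/

section EquivalenceRelation

variable {A E : ExReg X} (p q : E ⟶ A)

/-- The relation on the carrier induced by a parallel pair. -/
noncomputable def spanRel : Subobject (A.carrier ⨯ A.carrier) :=
  InternalRel.comp (op (Hom.rel p)) (Hom.rel q)

variable {p q}

lemma holds_spanRel {T : X} {a b : T ⟶ A.carrier} :
    Holds (spanRel p q) a b ↔ ∃ (T' : X) (e : T' ⟶ T) (_ : StrongEpi e) (t : T' ⟶ E.carrier),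
      Rel p t (e ≫ a) ∧ Rel q t (e ≫ b) := by
  simp only [spanRel, holds_comp, holds_op]
  rfl

lemma holds_spanRel_of_rel {T : X} {a b : T ⟶ A.carrier} {t : T ⟶ E.carrier} (h : Rel p t a)
    (h' : Rel q t b) : Holds (spanRel p q) a b :=
  holds_spanRel.2 ⟨T, 𝟙 _, inferInstance, t, by simpa using h, by simpa using h'⟩

lemma holds_spanRel_of_eqv (r : ReflexiveRelation p q) {T : X} {a b : T ⟶ A.carrier}
    (h : Eqv A a b) : Holds (spanRel p q) a b := by
  obtain ⟨T', e, _, t, ht⟩ := Rel.exists r.r a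
  refine holds_spanRel.2 ⟨T', e, ‹_›, t, Rel.of_comp (F := r.r) (a := e ≫ a) ?_ ht,
    Rel.of_comp (F := r.r) (a := e ≫ a) ?_ ht⟩
  · rw [r.reflexivity₁]
    exact rel_id.2 (Eqv.refl _)
  · rw [r.reflexivity₂]
    exact rel_id.2 (h.precomp e)

lemma holds_spanRel_symm (s : SymmetricRelation p q) {T : X} {a b : T ⟶ A.carrier}
    (h : Holds (spanRel p q) a b) : Holds (spanRel p q) b a := by
  obtain ⟨T₁, e₁, _, t, h1, h2⟩ := holds_spanRel.1 h
  obtain ⟨T₂, e₂, _, t', ht⟩ := Rel.exists s.s t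
  have : StrongEpi (e₂ ≫ e₁) := strongEpi_comp _ _
  refine Holds.of_strongEpi (e₂ ≫ e₁) (holds_spanRel_of_rel (t := t') ?_ ?_)
  · refine Rel.of_comp (F := s.s) (a := e₂ ≫ t) ?_ ht
    rw [s.symmetry₁, Category.assoc]
    exact h2.precomp e₂
  · refine Rel.of_comp (F := s.s) (a := e₂ ≫ t) ?_ ht
    rw [s.symmetry₂, Category.assoc]
    exact h1.precomp e₂

lemma holds_spanRel_trans (s : TransitiveRelation p q) {T : X} {a b c : T ⟶ A.carrier}
    (h : Holds (spanRel p q) a b) (h' : Holds (spanRel p q) b c) :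
    Holds (spanRel p q) a c := by
  obtain ⟨T₁, e₁, _, t₁, h1, h2⟩ := holds_spanRel.1 h
  obtain ⟨T₂, e₂, _, t₂, h3, h4⟩ := holds_spanRel.1 (h'.precomp e₁)
  have hp : IsPullback s.c.fst s.c.snd q p := ⟨⟨s.c.condition⟩, ⟨s.isLimit.ofIsoLimit s.c.eta⟩⟩
  obtain ⟨T₃, e₃, _, z, h5, h6⟩ := exists_of_isPullback hp (h2.precomp e₂) h3
  obtain ⟨T₄, e₄, _, t₃, ht₃⟩ := Rel.exists s.t z
  have : StrongEpi (e₄ ≫ e₃ ≫ e₂ ≫ e₁) := by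
    have := strongEpi_comp e₂ e₁
    have := strongEpi_comp e₃ (e₂ ≫ e₁)
    exact strongEpi_comp _ _
  refine Holds.of_strongEpi (e₄ ≫ e₃ ≫ e₂ ≫ e₁) (holds_spanRel_of_rel (t := t₃) ?_ ?_)
  · refine Rel.of_comp (F := s.t) (a := e₄ ≫ z) ?_ ht₃
    rw [s.transitivity₁]
    simpa using (h5.comp ((h1.precomp e₂).precomp e₃)).precomp e₄
  · refine Rel.of_comp (F := s.t) (a := e₄ ≫ z) ?_ ht₃
    rw [s.transitivity₂]
    simpa using (h6.comp (h4.precomp e₃)).precomp e₄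

/-- The quotient keeps the carrier and enlarges its relation to the one spanned by `E`; the
projection is induced by the identity. Elements identified in the quotient come locally from `E`, so
joint monicity of `p, q` makes `E` the kernel pair. -/
lemma exists_isKernelPair_surj (h : IsEquivalenceRelation p q) :
    ∃ (Q : ExReg X) (f : A ⟶ Q), IsKernelPair f p q ∧ Surj f := by
  obtain ⟨r⟩ := h.nonempty_equivalenceRelation
  let Q : ExReg X := objMk A.carrier (spanRel p q)
    (fun _ a => holds_spanRel_of_eqv r.toReflexiveRelation (Eqv.refl a))
    (fun _ _ _ h => holds_spanRel_symm r.toSymmetricRelation h)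
    (fun _ _ _ _ h h' => holds_spanRel_trans r.toTransitiveRelation h h')
  let f : A ⟶ Q := homOfMap (B := Q) (𝟙 A.carrier) fun T a a' h =>
    holds_spanRel_of_eqv r.toReflexiveRelation
      ((Category.comp_id a).symm ▸ (Category.comp_id a').symm ▸ h)
  have hf {T : X} {a : T ⟶ A.carrier} {b : T ⟶ A.carrier} :
      Rel (B := Q) f a b ↔ Holds (spanRel p q) a b :=
    rel_homOfMap.trans (Iff.of_eq (congrArg
      (fun z : T ⟶ A.carrier => Holds (spanRel p q) z b) (Category.comp_id a)))
  refine ⟨Q, f, isPullback_of_injPair (hom_ext' fun T t (b : T ⟶ A.carrier) hb => ?_)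
    (InjPair.of_jointlyMono₂ r.toReflexiveRelation.toJointlyMono₂)
    fun T a b (c : T ⟶ A.carrier) h1 h2 => ?_,
    fun T b => ⟨T, 𝟙 _, inferInstance, b, (hf (b := 𝟙 _ ≫ b)).2 ?_⟩⟩
  · obtain ⟨T₁, e₁, _, a, h1, h2⟩ := rel_comp.1 hb
    have h2 := hf.1 h2
    obtain ⟨T₂, e₂, _, a', h3⟩ := Rel.exists q (e₁ ≫ t)
    refine Rel.of_strongEpi e₁ (Rel.of_strongEpi e₂ (h3.comp (hf.2 ?_)))
    exact holds_spanRel_trans r.toTransitiveRelation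
      (holds_spanRel_symm r.toSymmetricRelation (holds_spanRel_of_rel (h1.precomp e₂) h3))
      (h2.precomp e₂)
  · exact holds_spanRel.1 (holds_spanRel_trans r.toTransitiveRelation (hf.1 h1)
      (holds_spanRel_symm r.toSymmetricRelation (hf.1 h2)))
  · exact holds_spanRel_of_eqv r.toReflexiveRelation (Eqv.of_eq (Category.id_comp b).symm)

end EquivalenceRelation

instance : Regular (ExReg X) where
  hasCoequalizer_of_isKernelPair {A B R f p q} h := by
    obtain ⟨Q, g, hg, hs⟩ := exists_isKernelPair_surj
      (h.equivalenceRelation f p q (pullback.isLimit q p)).isEquivalenceRelation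
    have := hs.isRegularEpi
    exact ⟨⟨⟨_, hg.toCoequalizer (IsRegularEpi.getStruct g)⟩⟩⟩
  regularEpiIsStableUnderBaseChange :=
    { of_isPullback := fun {A B C D f g f' g'} h hg => by
        have : IsRegularEpi g := hg
        exact ((surj_of_isRegularEpi g).of_isPullback h).isRegularEpi }

lemma isExactCategory : IsExactCategory (ExReg X) where
  regular := inferInstance
  exists_isKernelPair R A p q h := by
    obtain ⟨Q, g, hg, -⟩ := exists_isKernelPair_surj h
    exact ⟨Q, g, hg⟩

/-- The spanned relation on the carrier is reflexive in `X`, hence an equivalence relation there.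
Its symmetry and transitivity are local statements about elements of `E`, which
`InjPair.exists_lift` turns into structural morphisms. -/
lemma isMaltsevCategory (hX : IsMaltsevCategory X) : IsMaltsevCategory (ExReg X) where
  hasFiniteLimits := inferInstance
  isEquivalenceRelation R A p q r := by
    obtain ⟨d, hd₁, hd₂⟩ := holds_iff_exists.1
      (holds_spanRel_of_eqv r (Eqv.refl (𝟙 A.carrier)))
    have he := hX.isEquivalenceRelation _ _
      { jointlyMono₂_arrow (spanRel p q) with r := d, reflexivity₁ := hd₁, reflexivity₂ := hd₂ }
    have hi := InjPair.of_jointlyMono₂ r.toJointlyMono₂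
    obtain ⟨s, hs₁, hs₂⟩ := hi.exists_lift q p fun T t a b ha hb =>
      holds_spanRel.1 (holds_symm_of_isEquivalenceRelation he (holds_spanRel_of_rel hb ha))
    have hc : pullback.fst q p ≫ q = pullback.snd q p ≫ p := pullback.condition
    obtain ⟨t, ht₁, ht₂⟩ := hi.exists_lift (pullback.fst q p ≫ p) (pullback.snd q p ≫ q)
      fun T w a c ha hc' => by
        obtain ⟨T₁, e₁, _, x, hx⟩ := Rel.exists (pullback.fst q p) w
        obtain ⟨T₂, e₂, _, y, hy⟩ := Rel.exists (pullback.snd q p) (e₁ ≫ w)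
        obtain ⟨T₃, e₃, _, b, hb⟩ := Rel.exists q (e₂ ≫ x)
        have hx' := (hx.precomp e₂).precomp e₃
        have hb' : Rel p (e₃ ≫ y) b := Rel.of_comp (hc ▸ hx'.comp hb) (hy.precomp e₃)
        have ha' : Rel p (e₃ ≫ e₂ ≫ x) (e₃ ≫ e₂ ≫ e₁ ≫ a) :=
          Rel.of_comp (((ha.precomp e₁).precomp e₂).precomp e₃) hx'
        have hc'' : Rel q (e₃ ≫ y) (e₃ ≫ e₂ ≫ e₁ ≫ c) :=
          Rel.of_comp (((hc'.precomp e₁).precomp e₂).precomp e₃) (hy.precomp e₃)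
        have : StrongEpi (e₂ ≫ e₁) := strongEpi_comp _ _
        have : StrongEpi (e₃ ≫ e₂ ≫ e₁) := strongEpi_comp _ _
        refine holds_spanRel.1 (Holds.of_strongEpi (e₃ ≫ e₂ ≫ e₁) ?_)
        simpa using holds_trans_of_isEquivalenceRelation he (holds_spanRel_of_rel ha' hb)
          (holds_spanRel_of_rel hb' hc'')
    exact ⟨⟨{ r with
      s := s, symmetry₁ := hs₁, symmetry₂ := hs₂
      c := pullback.cone _ _, isLimit := pullback.isLimit _ _
      t := t, transitivity₁ := ht₁, transitivity₂ := ht₂ }⟩⟩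

end ExReg

/-! ### Arrows inverted by a reflector -/

section Reflective

variable {X : Type u} [Category.{v} X] {C : Type u'} [Category.{v'} C]

/-- A morphism to an object of the subcategory is inverted by the reflector if and only if it has
the universal property of the unit. -/
lemma isIso_reflector_map_iff {U : X ⥤ C} [Reflective U] {P : C} {Y : X} (a : P ⟶ U.obj Y) :
    IsIso ((reflector U).map a) ↔
      ∀ Z : X, Function.Bijective fun g : Y ⟶ Z => a ≫ U.map g := by
  let adj := reflectorAdjunction U
  rw [isIso_iff_coyoneda_map_bijective]
  refine forall_congr' fun Z => ?_
  let φ : (Y ⟶ Z) ≃ ((reflector U).obj (U.obj Y) ⟶ Z) :=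
    (U.fullyFaithfulOfReflective.homEquiv (X := Y) (Y := Z)).trans
      (adj.homEquiv (U.obj Y) Z).symm
  have h1 : (fun g : Y ⟶ Z => a ≫ U.map g) =
      adj.homEquiv P Z ∘ (fun x => (reflector U).map a ≫ x) ∘ φ := by
    funext g
    rw [Function.comp_apply, Function.comp_apply, adj.homEquiv_naturality_left]
    exact congrArg (a ≫ ·) (Equiv.apply_symm_apply (adj.homEquiv (U.obj Y) Z) (U.map g)).symm
  rw [h1, Function.Bijective.of_comp_iff' (Equiv.bijective _),
    Function.Bijective.of_comp_iff _ (Equiv.bijective _)]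

end Reflective

/-! ### The exact completion reflected onto the regular category -/

namespace ExReg

open InternalRel

variable {X : Type u} [Category.{v} X] [Regular X]

section ToEmbedding

variable {A : ExReg X} {Y Z : X}

/-- The morphism to an object in the image of the embedding induced by a compatible morphism. -/
noncomputable def toEmbedding (f : A.carrier ⟶ Y)
    (hf : ∀ ⦃T : X⦄ (a a' : T ⟶ A.carrier), Eqv A a a' → a ≫ f = a' ≫ f) :
    A ⟶ (embedding X).obj Y :=
  homOfMap (B := (embedding X).obj Y) f fun _ _ _ h => eqv_embedding.2 (hf _ _ h)

lemma rel_toEmbedding {f : A.carrier ⟶ Y} {hf} {T : X} {a : T ⟶ A.carrier} {y : T ⟶ Y} :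
    Rel (toEmbedding f hf) a y ↔ a ≫ f = y :=
  rel_homOfMap.trans eqv_embedding

lemma toEmbedding_comp_map (f : A.carrier ⟶ Y) (hf) (g : Y ⟶ Z) :
    toEmbedding f hf ≫ (embedding X).map g =
      toEmbedding (f ≫ g) fun T a a' h => by
        rw [← Category.assoc, hf a a' h, Category.assoc] := by
  refine (hom_ext' fun T a (z : T ⟶ Z) h => ?_).symm
  have h1 : Rel (toEmbedding f hf) a (a ≫ f) := rel_toEmbedding.2 rfl
  exact h1.comp (rel_embedding_map.2 ((Category.assoc a f g).trans (rel_toEmbedding.1 h)))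

lemma toEmbedding_inj {f g : A.carrier ⟶ Y} {hf hg} :
    toEmbedding f hf = toEmbedding g hg ↔ f = g := by
  refine ⟨fun h => ?_, fun h => by subst h; rfl⟩
  have h1 : Rel (toEmbedding f hf) (𝟙 _) f := rel_toEmbedding.2 (Category.id_comp f)
  rw [h] at h1
  exact (rel_toEmbedding.1 h1).symm.trans (Category.id_comp g)

/-- Precomposing with the projection from the embedded carrier gives, by fullness, a morphism of
`X`; it determines `F` and respects the relation of `A`. Reflecting `A` thus amounts to forming a
coequalizer in `X`. -/
lemma exists_eq_toEmbedding (F : A ⟶ (embedding X).obj Y) :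
    ∃ (f : A.carrier ⟶ Y) (hf : ∀ ⦃T : X⦄ (a a' : T ⟶ A.carrier), Eqv A a a' → a ≫ f = a' ≫ f),
      F = toEmbedding f hf := by
  obtain ⟨f, hf⟩ := (embedding X).map_surjective (point A (𝟙 A.carrier) ≫ F)
  have key {T : X} (a : T ⟶ A.carrier) : Rel F a (a ≫ f) := by
    have h1 : Rel ((embedding X).map f) a (a ≫ f) := rel_embedding_map.2 rfl
    rw [hf] at h1
    exact h1.of_comp (rel_point.2 (Eqv.of_eq (Category.comp_id a)))
  refine ⟨f, fun T a a' h => eqv_embedding.1 ((key a).unique ((key a').left h)),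
    hom_ext' fun T a (y : T ⟶ Y) h => rel_toEmbedding.2 ?_⟩
  exact eqv_embedding.1 ((key a).unique h)

end ToEmbedding

/-- The unit corresponds to some `f` in `X`. It factors through the image of `f`, so universality
gives a section of the image inclusion. That mono is then invertible, `f` is a strong epimorphism,
and the unit is surjective on elements. -/
lemma isRegularEpi_unit [Reflective (embedding X)] (Q : ExReg X) :
    IsRegularEpi ((reflectorAdjunction (embedding X)).unit.app Q) := by
  let adj := reflectorAdjunction (embedding X)
  obtain ⟨f, hf, hη⟩ := exists_eq_toEmbedding (A := Q) (adj.unit.app Q)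
  let fac := Regular.strongEpiMonoFactorisation f
  let e := toEmbedding (A := Q) fac.e fun T a a' h => by
    rw [← cancel_mono fac.m]
    simpa using hf a a' h
  have he : e ≫ (embedding X).map fac.m = adj.unit.app Q := by
    rw [toEmbedding_comp_map, hη, toEmbedding_inj, fac.fac]
  let g := (adj.homEquiv _ _).symm e
  have hg : adj.unit.app Q ≫ (embedding X).map g = e := by
    exact (adj.homEquiv_unit _ _ _).symm.trans (Equiv.apply_symm_apply _ _)
  have hgm : g ≫ fac.m = 𝟙 _ := by
    apply (adj.homEquiv _ _).injective
    rw [adj.homEquiv_unit, adj.homEquiv_unit, Functor.map_comp, reassoc_of% hg, he,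
      CategoryTheory.Functor.map_id]
    exact (Category.comp_id _).symm
  have : IsSplitEpi fac.m := ⟨⟨⟨g, hgm⟩⟩⟩
  have : IsIso fac.m := isIso_of_mono_of_isSplitEpi _
  have : StrongEpi f := by
    rw [← fac.fac]
    exact strongEpi_comp _ _
  refine Surj.isRegularEpi (F := adj.unit.app Q) ?_
  rw [hη]
  intro T (b : T ⟶ (reflector (embedding X)).obj Q)
  have : IsRegularEpi f := inferInstance
  have : StrongEpi (pullback.snd f b) := inferInstance
  exact ⟨_, pullback.snd f b, inferInstance, pullback.fst f b,
    rel_toEmbedding.2 pullback.condition⟩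

section Reflection

lemma isEquivalenceRelation_rel (A : ExReg X) :
    IsEquivalenceRelation (A.rel.arrow ≫ prod.fst) (A.rel.arrow ≫ prod.snd) :=
  isEquivalenceRelation_arrow (fun _ a => Eqv.refl a) (fun _ _ _ h => Eqv.symm h)
    (fun _ _ _ _ h h' => Eqv.trans h h')

lemma exists_quotient (hX : HasStableCoequalizersOfEquivalenceRelations X) (A : ExReg X) :
    ∃ (L : X) (q : A.carrier ⟶ L)
      (w : (A.rel.arrow ≫ prod.fst) ≫ q = (A.rel.arrow ≫ prod.snd) ≫ q),
      Nonempty (IsColimit (Cofork.ofπ q w)) := by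
  have := hX.hasCoequalizer _ _ A.isEquivalenceRelation_rel
  exact ⟨_, _, coequalizer.condition _ _, ⟨coequalizerIsCoequalizer _ _⟩⟩

lemma comp_eq_of_eqv {A : ExReg X} {L : X} {q : A.carrier ⟶ L}
    (w : (A.rel.arrow ≫ prod.fst) ≫ q = (A.rel.arrow ≫ prod.snd) ≫ q) ⦃T : X⦄
    (a a' : T ⟶ A.carrier) (h : Eqv A a a') : a ≫ q = a' ≫ q := by
  obtain ⟨k, rfl, rfl⟩ := holds_iff_exists.1 h
  rw [Category.assoc, w, ← Category.assoc]

lemma bijective_toEmbedding_comp_map {A : ExReg X} {Y Z : X} (x : A.carrier ⟶ Y)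
    (hx : ∀ ⦃T : X⦄ (a a' : T ⟶ A.carrier), Eqv A a a' → a ≫ x = a' ≫ x)
    (hinj : ∀ g g' : Y ⟶ Z, x ≫ g = x ≫ g' → g = g')
    (hdesc : ∀ k : A.carrier ⟶ Z,
      (∀ ⦃T : X⦄ (a a' : T ⟶ A.carrier), Eqv A a a' → a ≫ k = a' ≫ k) → ∃ g, x ≫ g = k) :
    Function.Bijective fun g : Y ⟶ Z => toEmbedding x hx ≫ (embedding X).map g := by
  constructor
  · intro g g' h
    simp only [toEmbedding_comp_map, toEmbedding_inj] at h
    exact hinj g g' h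
  · intro F
    obtain ⟨k, hk, rfl⟩ := exists_eq_toEmbedding F
    obtain ⟨g, hg⟩ := hdesc k hk
    exact ⟨g, (toEmbedding_comp_map _ _ _).trans (toEmbedding_inj.2 hg)⟩

lemma bijective_quotient_comp_map {A : ExReg X} {L : X} {q : A.carrier ⟶ L}
    {w : (A.rel.arrow ≫ prod.fst) ≫ q = (A.rel.arrow ≫ prod.snd) ≫ q}
    (hq : Nonempty (IsColimit (Cofork.ofπ q w))) (Z : X) :
    Function.Bijective
      fun g : L ⟶ Z => toEmbedding q (comp_eq_of_eqv w) ≫ (embedding X).map g := by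
  obtain ⟨hq⟩ := hq
  refine bijective_toEmbedding_comp_map _ _ (fun g g' h => Cofork.IsColimit.hom_ext hq h)
    fun k hk => ?_
  obtain ⟨g, hg⟩ := Cofork.IsColimit.desc' hq k (hk _ _ (holds_arrow A.rel))
  exact ⟨g, hg⟩

/-- The concrete pullback `pb` has as carrier the pullback of `f` and `q` in `X`. Stability makes
its projection to `Y` a coequalizer of a pair identified in `pb`, which is the universal property
sought. -/
lemma bijective_comp_map_of_isPullback (hX : HasStableCoequalizersOfEquivalenceRelations X)
    {Q : ExReg X} {L : X} {q : Q.carrier ⟶ L}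
    {w : (Q.rel.arrow ≫ prod.fst) ≫ q = (Q.rel.arrow ≫ prod.snd) ≫ q}
    (hq : Nonempty (IsColimit (Cofork.ofπ q w))) {P : ExReg X} {Y : X} {f : Y ⟶ L}
    {a : P ⟶ (embedding X).obj Y} {b : P ⟶ Q}
    (h : IsPullback a b ((embedding X).map f) (toEmbedding q (comp_eq_of_eqv w))) (Z : X) :
    Function.Bijective fun g : Y ⟶ Z => a ≫ (embedding X).map g := by
  let F := (embedding X).map f
  let G := toEmbedding q (comp_eq_of_eqv w)
  let x : (pairs F G : X) ⟶ Y := pairsFst F G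
  let y : (pairs F G : X) ⟶ Q.carrier := pairsSnd F G
  have hx {T : X} (s : T ⟶ Y) (t : T ⟶ Q.carrier) (hst : s ≫ f = t ≫ q) :
      ∃ k : T ⟶ (pairs F G : X), k ≫ x = s ∧ k ≫ y = t :=
    holds_iff_exists.1 (holds_pairs.2 ⟨T, 𝟙 _, inferInstance, s ≫ f,
      rel_embedding_map.2 (congrArg (· ≫ f) (Category.id_comp s)),
      rel_toEmbedding.2 ((congrArg (· ≫ q) (Category.id_comp t)).trans
        hst.symm)⟩)
  have hxy : x ≫ f = y ≫ q := by
    obtain ⟨T, e, _, c, h1, h2⟩ := holds_pairs.1 (holds_arrow (pairs F G))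
    -- The common image exists on a cover only, but `L` carries the equality relation, so the
    -- equation descends.
    rw [← cancel_epi e]
    have h1 := rel_embedding_map.1 h1
    have h2 := rel_toEmbedding.1 h2
    rw [Category.assoc] at h2
    exact ((Category.assoc _ _ _).symm.trans h1).trans h2.symm
  have hpb : IsPullback x y f q := by
    have := fun s : PullbackCone f q => hx s.fst s.snd s.condition
    choose l hl₁ hl₂ using this
    refine ⟨⟨hxy⟩, ⟨PullbackCone.IsLimit.mk hxy l hl₁ hl₂ fun s m h₁ h₂ => ?_⟩⟩
    exact (jointlyMono₂_arrow (pairs F G)).right_cancellation _ _ (h₁.trans (hl₁ s).symm)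
      (h₂.trans (hl₂ s).symm)
  let p₁ := Q.rel.arrow ≫ prod.fst
  let p₂ := Q.rel.arrow ≫ prod.snd
  -- The relation of `Q` pulled back along `f`; its two legs `r₁, r₂` into the carrier of `pb`
  -- complete the pulled back coequalizer diagram.
  let t := pullback.fst f (p₁ ≫ q)
  let s := pullback.snd f (p₁ ≫ q)
  have hts : t ≫ f = s ≫ p₁ ≫ q := pullback.condition
  obtain ⟨r₁, h₁, h₁'⟩ := hx t (s ≫ p₁) (hts.trans (Category.assoc _ _ _).symm)
  obtain ⟨r₂, h₂, h₂'⟩ := hx t (s ≫ p₂) ((hts.trans (congrArg (s ≫ ·) w)).trans (Category.assoc _ _ _).symm)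
  have hcoeq := hX.stable p₁ p₂ q w Q.isEquivalenceRelation_rel hq f x y t s r₁ r₂ hpb
    (IsPullback.of_hasPullback _ _) h₁' h₂' h₁ h₂
  obtain ⟨hcoeq⟩ := hcoeq
  have hr : Eqv (pb F G) r₁ r₂ := (eqv_pb F G).2 ⟨eqv_embedding.2 (h₁.trans h₂.symm), by
    change Eqv Q (r₁ ≫ y) (r₂ ≫ y)
    rw [h₁', h₂']
    exact Holds.precomp (holds_arrow Q.rel) s⟩
  have hcompat ⦃T : X⦄ (c c' : T ⟶ (pb F G).carrier) (hc : Eqv (pb F G) c c') :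
      c ≫ x = c' ≫ x :=
    eqv_embedding.1 ((eqv_pb F G).1 hc).1
  have key := bijective_toEmbedding_comp_map (A := pb F G) x hcompat (Z := Z)
    (fun g g' hg => Cofork.IsColimit.hom_ext hcoeq hg) fun k hk => by
      obtain ⟨g, hg⟩ := Cofork.IsColimit.desc' hcoeq k (hk _ _ hr)
      exact ⟨g, hg⟩
  let i : P ≅ pb F G := h.isoIsPullback _ _ (isPullback_pb F G)
  have hi : i.hom ≫ toEmbedding (A := pb F G) x hcompat = a := h.isoIsPullback_hom_fst _ _ _
  have hcomp : (fun g : Y ⟶ Z => a ≫ (embedding X).map g) = (fun k => i.hom ≫ k) ∘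
      fun g : Y ⟶ Z => toEmbedding (A := pb F G) x hcompat ≫ (embedding X).map g := by
    funext g
    rw [← hi]
    exact Category.assoc _ _ _
  rw [hcomp]
  exact (i.homFromEquiv (Z := (embedding X).obj Z)).symm.bijective.comp key

lemma isSemiLocalization_embedding (hX : HasStableCoequalizersOfEquivalenceRelations X) :
    IsSemiLocalization (embedding X) := by
  choose L q w hq using exists_quotient hX
  let e (A : ExReg X) (Z : X) : (L A ⟶ Z) ≃ (A ⟶ (embedding X).obj Z) :=
    Equiv.ofBijective _ (bijective_quotient_comp_map (hq A) Z)
  have he (A : ExReg X) (Y Z : X) (g : Y ⟶ Z) (h : L A ⟶ Y) :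
      e A Z (h ≫ g) = e A Y h ≫ (embedding X).map g := by
    simp [e]
  let adj := Adjunction.adjunctionOfEquivLeft e he
  let inst : Reflective (embedding X) := { L := _, adj := adj }
  refine ⟨inst, fun P Q Y f a b h => ?_⟩
  have hunit : (reflectorAdjunction (embedding X)).unit.app Q =
      toEmbedding (q Q) (comp_eq_of_eqv (w Q)) := by
    change adj.unit.app Q = _
    simp only [adj, Adjunction.adjunctionOfEquivLeft_unit_app]
    change toEmbedding (q Q) _ ≫ (embedding X).map (𝟙 _) = _
    rw [CategoryTheory.Functor.map_id]
    exact Category.comp_id _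
  rw [hunit] at h
  -- The reflector inverts both `a` and the unit, so the reflected square has two parallel
  -- isomorphisms.
  have := (isIso_reflector_map_iff a).2 (bijective_comp_map_of_isPullback hX (hq Q) h)
  exact IsPullback.of_horiz_isIso ⟨by rw [← Functor.map_comp, ← Functor.map_comp, h.w, hunit]⟩

end Reflection
end ExReg

/-- A finitely complete category with stable coequalizers of equivalence relations is regular. -/
lemma HasStableCoequalizersOfEquivalenceRelations.regular {X : Type u} [Category.{v} X]
    [HasFiniteLimits X] (h : HasStableCoequalizersOfEquivalenceRelations X) : Regular X where
  hasCoequalizer_of_isKernelPair {A B R f p q} hf := h.hasCoequalizer p q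
    (hf.equivalenceRelation f p q (pullback.isLimit q p)).isEquivalenceRelation
  regularEpiIsStableUnderBaseChange :=
    { of_isPullback := fun {A Y Y' S f g x q'} sq (hg : IsRegularEpi g) => by
        have hk := IsKernelPair.of_hasPullback g
        let p₁ := pullback.fst g g
        let p₂ := pullback.snd g g
        have hp : p₁ ≫ g = p₂ ≫ g := pullback.condition
        have hw : pullback.fst f (p₁ ≫ g) ≫ f = pullback.snd f (p₁ ≫ g) ≫ p₁ ≫ g :=
          pullback.condition
        have hw' : pullback.fst f (p₁ ≫ g) ≫ f = (pullback.snd f (p₁ ≫ g) ≫ p₂) ≫ g :=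
          (hw.trans (congrArg (_ ≫ ·) hp)).trans (Category.assoc _ _ _).symm
        obtain ⟨hc⟩ := h.stable p₁ p₂ g hp
          (hk.equivalenceRelation g p₁ p₂ (pullback.isLimit p₂ p₁)).isEquivalenceRelation
          ⟨hk.toCoequalizer'⟩ f q' x _ _
          (sq.flip.lift _ _ (hw.trans (Category.assoc _ _ _).symm))
          (sq.flip.lift _ _ hw') sq.flip (IsPullback.of_hasPullback _ _)
          (sq.flip.lift_snd _ _ _) (sq.flip.lift_snd _ _ _)
          (sq.flip.lift_fst _ _ _) (sq.flip.lift_fst _ _ _)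
        exact ⟨⟨Cofork.IsColimit.regularEpi hc⟩⟩ }

/-! ### From a semi-localization to stable coequalizers -/

section Reflective

variable {X : Type u} [Category.{v} X] {C : Type u'} [Category.{v'} C] (U : X ⥤ C)

section Adjunction

variable [U.IsRightAdjoint] {R A : X} {p q : R ⟶ A}

lemma JointlyMono₂.map_of_isRightAdjoint (h : JointlyMono₂ p q) :
    JointlyMono₂ (U.map p) (U.map q) where
  right_cancellation W f g h₁ h₂ := by
    let adj := Adjunction.ofIsRightAdjoint U
    apply (adj.homEquiv _ _).symm.injective
    apply h.right_cancellation
    · rw [← adj.homEquiv_naturality_right_symm, ← adj.homEquiv_naturality_right_symm, h₁]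
    · rw [← adj.homEquiv_naturality_right_symm, ← adj.homEquiv_naturality_right_symm, h₂]

lemma IsEquivalenceRelation.map_of_isRightAdjoint (h : IsEquivalenceRelation p q) :
    IsEquivalenceRelation (U.map p) (U.map q) := by
  obtain ⟨e⟩ := h.nonempty_equivalenceRelation
  have := JointlyMono₂.map_of_isRightAdjoint U e.toReflexiveRelation.toJointlyMono₂
  have : PreservesLimitsOfSize.{0, 0} U := (Adjunction.ofIsRightAdjoint U).rightAdjoint_preservesLimits
  exact ⟨⟨{ e.toReflexiveRelation.map U, e.toSymmetricRelation.map U,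
    e.toTransitiveRelation.map U with }⟩⟩

end Adjunction

/-- `U` turns a reflexive relation into one in `C`, where it is an equivalence relation; full
faithfulness brings the structural morphisms back. -/
lemma isMaltsevCategory_of_reflective [Reflective U] (hC : IsMaltsevCategory C) :
    IsMaltsevCategory X where
  hasFiniteLimits := by
    have := hC.hasFiniteLimits
    exact ⟨fun J _ _ => hasLimitsOfShape_of_reflective U⟩
  isEquivalenceRelation R A p q r := by
    have := hC.hasFiniteLimits
    have : HasFiniteLimits X := ⟨fun J _ _ => hasLimitsOfShape_of_reflective U⟩
    have := JointlyMono₂.map_of_isRightAdjoint U r.toJointlyMono₂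
    obtain ⟨e⟩ := (hC.isEquivalenceRelation _ _ (r.map U)).nonempty_equivalenceRelation
    obtain ⟨s, hs⟩ := U.map_surjective e.s
    have hc : pullback.fst q p ≫ q = pullback.snd q p ≫ p := pullback.condition
    obtain ⟨l, hl₁, hl₂⟩ := PullbackCone.IsLimit.lift' e.isLimit (U.map (pullback.fst q p))
      (U.map (pullback.snd q p)) (by rw [← U.map_comp, ← U.map_comp, hc])
    obtain ⟨t, ht⟩ := U.map_surjective (l ≫ e.t)
    exact ⟨⟨{ r with
      s := s
      symmetry₁ := U.map_injective (by rw [U.map_comp, hs, e.symmetry₁])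
      symmetry₂ := U.map_injective (by rw [U.map_comp, hs, e.symmetry₂])
      c := pullback.cone q p
      isLimit := pullback.isLimit q p
      t := t
      transitivity₁ := U.map_injective (by
        rw [U.map_comp, ht, Category.assoc, e.transitivity₁, reassoc_of% hl₁, ← U.map_comp]
        rfl)
      transitivity₂ := U.map_injective (by
        rw [U.map_comp, ht, Category.assoc, e.transitivity₂, reassoc_of% hl₂, ← U.map_comp]
        rfl) }⟩⟩

variable {U}

/-- A reflector that is semi-left-exact preserves the universal property of the unit under pullback
along morphisms of the subcategory. -/
lemma IsSemiLeftExactReflection.bijective_of_isPullback [Reflective U]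
    (hU : IsSemiLeftExactReflection U) {P Q : C} {L Y : X} {η : Q ⟶ U.obj L} {f : Y ⟶ L}
    {a : P ⟶ U.obj Y} {b : P ⟶ Q} (hη : ∀ Z : X, Function.Bijective fun g : L ⟶ Z => η ≫ U.map g)
    (h : IsPullback a b (U.map f) η) (Z : X) :
    Function.Bijective fun g : Y ⟶ Z => a ≫ U.map g := by
  let adj := reflectorAdjunction U
  have := (isIso_reflector_map_iff η).2 hη
  -- The comparison of the chosen reflection with `L` is invertible because `η` is universal.
  -- Correcting `f` by its inverse gives a pullback of the actual unit, to which semi-left-exactness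
  -- applies.
  let θ : (reflector U).obj Q ⟶ L := (reflector U).map η ≫ adj.counit.app L
  have hθ : adj.unit.app Q ≫ U.map θ = η := by
    simp [θ, adj]
  have : IsIso ((reflector U).map (adj.unit.app Q)) :=
    (isIso_reflector_map_iff _).2 fun Z => by
      convert! (adj.homEquiv Q Z).bijective using 1
  have sq : IsPullback a b (U.map (f ≫ inv θ)) (adj.unit.app Q) := by
    refine h.of_iso (Iso.refl _) (Iso.refl _) (Iso.refl _) (asIso (U.map (inv θ))) ?_ ?_ ?_ ?_
    · simp
    · simp
    · simp
    · simp [← hθ]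
  have hL := hU _ _ _ sq
  have : IsIso ((reflector U).map a) := hL.isIso_fst_of_isIso
  exact (isIso_reflector_map_iff a).1 this Z

/-- Quotients of equivalence relations in an exact category. -/
lemma IsExactCategory.exists_isKernelPair_isRegularEpi (hC : IsExactCategory C) {R A : C}
    {p q : R ⟶ A} (h : IsEquivalenceRelation p q) :
    ∃ (Q : C) (f : A ⟶ Q), IsKernelPair f p q ∧ IsRegularEpi f := by
  have := hC.regular
  obtain ⟨Y, f, hf⟩ := hC.exists_isKernelPair p q h
  -- Dropping the mono part of `f` leaves the kernel pair unchanged.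
  let fac := Regular.strongEpiMonoFactorisation f
  refine ⟨fac.I, fac.e, ?_, inferInstance⟩
  rw [← fac.fac] at hf
  exact hf.cancel_right_of_mono

/-- The reflection of a coequalizer is a coequalizer. -/
lemma nonempty_isColimit_cofork_of_universal [U.Full] [U.Faithful] {R A L : X} {p₁ p₂ : R ⟶ A}
    {q : A ⟶ L} (w : p₁ ≫ q = p₂ ≫ q) {P : C} {π : U.obj A ⟶ P} [Epi π] {η : P ⟶ U.obj L}
    (hπ : π ≫ η = U.map q) (hη : ∀ Z : X, Function.Bijective fun g : L ⟶ Z => η ≫ U.map g)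
    (hdesc : ∀ ⦃Z : X⦄ (k : A ⟶ Z), p₁ ≫ k = p₂ ≫ k → ∃ m : P ⟶ U.obj Z, π ≫ m = U.map k) :
    Nonempty (IsColimit (Cofork.ofπ q w)) := by
  have h (s : Cofork p₁ p₂) : ∃ g : L ⟶ s.pt, q ≫ g = s.π := by
    obtain ⟨m, hm⟩ := hdesc s.π s.condition
    obtain ⟨g, rfl⟩ := (hη s.pt).2 m
    exact ⟨g, U.map_injective (by rw [U.map_comp, ← hπ, Category.assoc, hm])⟩
  choose d hd using h
  refine ⟨Cofork.IsColimit.mk _ d hd fun s m hm => (hη _).1 ?_⟩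
  have hm : q ≫ m = q ≫ d s := hm.trans (hd s).symm
  change η ≫ U.map m = η ≫ U.map (d s)
  rw [← cancel_epi π, reassoc_of% hπ, reassoc_of% hπ, ← U.map_comp, hm, U.map_comp]

/-- The coequalizer in `X` is the quotient `π` in `C` followed by a universal arrow `η`. Both
factors keep their property under pullback along `U f`, and `nonempty_isColimit_cofork_of_universal`
recombines them. -/
lemma IsSemiLeftExactReflection.hasStableCoequalizers [Reflective U]
    (hU : IsSemiLeftExactReflection U) (hC : IsExactCategory C) :
    HasStableCoequalizersOfEquivalenceRelations X where
  hasCoequalizer R A p₁ p₂ h := by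
    have := hC.regular
    let adj := reflectorAdjunction U
    obtain ⟨Q, π, hπ, _⟩ :=
      hC.exists_isKernelPair_isRegularEpi (IsEquivalenceRelation.map_of_isRightAdjoint U h)
    obtain ⟨q, hq⟩ := U.map_surjective (π ≫ adj.unit.app Q)
    have w : p₁ ≫ q = p₂ ≫ q := U.map_injective (by
      rw [U.map_comp, U.map_comp, hq, hπ.w_assoc])
    obtain ⟨hc⟩ := nonempty_isColimit_cofork_of_universal w hq.symm
      (fun Z => by
        convert! (adj.homEquiv Q Z).bijective using 1)
      fun Z k hk => by
        obtain ⟨m, hm⟩ := Cofork.IsColimit.desc' hπ.toCoequalizer' (U.map k)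
          (by rw [← U.map_comp, ← U.map_comp, hk])
        exact ⟨m, hm⟩
    exact ⟨⟨⟨_, hc⟩⟩⟩
  stable R A L p₁ p₂ q w h hq S A' Y f q' x t s r₁ r₂ hA' hS hr₁ hr₂ w₁ w₂ := by
    have := hC.regular
    have : PreservesLimitsOfSize.{0, 0} U :=
      (reflectorAdjunction U).rightAdjoint_preservesLimits
    obtain ⟨hq⟩ := hq
    obtain ⟨Q, π, hπ, _⟩ :=
      hC.exists_isKernelPair_isRegularEpi (IsEquivalenceRelation.map_of_isRightAdjoint U h)
    have hπ' := hπ.toCoequalizer'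
    obtain ⟨η, hη⟩ := Cofork.IsColimit.desc' hπ' (U.map q) (by rw [← U.map_comp, ← U.map_comp, w])
    have hη : π ≫ η = U.map q := hη
    -- Arrows from `Q` to `U Z` correspond through `π` to arrows `A ⟶ Z` coequalizing `p₁, p₂`,
    -- hence to arrows `L ⟶ Z`.
    have hbij (Z : X) : Function.Bijective fun g : L ⟶ Z => η ≫ U.map g := by
      constructor
      · intro g g' (hg : η ≫ U.map g = η ≫ U.map g')
        refine Cofork.IsColimit.hom_ext hq (U.map_injective ?_)
        have := congrArg (π ≫ ·) hg
        simpa [reassoc_of% hη] using this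
      · intro m
        obtain ⟨k, hk⟩ := U.map_surjective (π ≫ m)
        obtain ⟨g, hg⟩ := Cofork.IsColimit.desc' hq k (U.map_injective (by
          rw [U.map_comp, U.map_comp, hk, hπ.w_assoc]))
        have hg : q ≫ g = k := hg
        refine ⟨g, ?_⟩
        rw [← cancel_epi π]
        change π ≫ η ≫ U.map g = _
        rw [reassoc_of% hη, ← U.map_comp, hg, hk]
    let a := pullback.fst (U.map f) η
    let b := pullback.snd (U.map f) η
    have hP : IsPullback a b (U.map f) η := IsPullback.of_hasPullback _ _
    have hUA : IsPullback (U.map q') (U.map x) (U.map f) (U.map q) := hA'.map U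
    have hUS : IsPullback (U.map t) (U.map s) (U.map f) (U.map (p₁ ≫ q)) := hS.map U
    let π' : U.obj A' ⟶ pullback (U.map f) η :=
      hP.lift (U.map q') (U.map x ≫ π) (by rw [Category.assoc, hη, hUA.w])
    have hπ'a : π' ≫ a = U.map q' := hP.lift_fst _ _ _
    have hπ'b : π' ≫ b = U.map x ≫ π := hP.lift_snd _ _ _
    -- Pullback pasting: the square for `q = π ≫ η` splits, exhibiting `π'` as a pullback of `π`.
    have sq : IsPullback (U.map x) π' π b := by
      refine (IsPullback.of_right ?_ hπ'b hP).flip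
      rw [hπ'a, hη]
      exact hUA
    have : IsRegularEpi π' :=
      Regular.regularEpiIsStableUnderBaseChange.of_isPullback sq ‹IsRegularEpi π›
    refine nonempty_isColimit_cofork_of_universal _ hπ'a (hU.bijective_of_isPullback hbij hP)
      fun Z k hk => ?_
    -- The kernel pair of `π'` factors through `U.map r₁, U.map r₂` by an arrow `n`, so any `k` that
    -- coequalizes `r₁, r₂` descends along `π'`.
    let g₁ := pullback.fst π' π'
    let g₂ := pullback.snd π' π'
    have hg : g₁ ≫ π' = g₂ ≫ π' := pullback.condition
    have hga : g₁ ≫ U.map q' = g₂ ≫ U.map q' := by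
      rw [← hπ'a, reassoc_of% hg]
    have hgb : (g₁ ≫ U.map x) ≫ π = (g₂ ≫ U.map x) ≫ π := by
      rw [Category.assoc, Category.assoc, ← hπ'b, reassoc_of% hg]
    let l := hπ.lift _ _ hgb
    have hl₁ : l ≫ U.map p₁ = g₁ ≫ U.map x := hπ.lift_fst _ _ hgb
    have hl₂ : l ≫ U.map p₂ = g₂ ≫ U.map x := hπ.lift_snd _ _ hgb
    have hw : (g₁ ≫ U.map q') ≫ U.map f = l ≫ U.map (p₁ ≫ q) := by
      rw [U.map_comp, reassoc_of% hl₁, Category.assoc, hUA.w]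
    let n := hUS.lift _ _ hw
    have hn₁ : n ≫ U.map t = g₁ ≫ U.map q' := hUS.lift_fst _ _ hw
    have hn₂ : n ≫ U.map s = l := hUS.lift_snd _ _ hw
    have e₁ : n ≫ U.map r₁ = g₁ := by
      refine hUA.hom_ext ?_ ?_
      · rw [Category.assoc, ← U.map_comp, w₁, hn₁]
      · rw [Category.assoc, ← U.map_comp, hr₁, U.map_comp, reassoc_of% hn₂, hl₁]
    have e₂ : n ≫ U.map r₂ = g₂ := by
      refine hUA.hom_ext ?_ ?_
      · rw [Category.assoc, ← U.map_comp, w₂, hn₁, hga]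
      · rw [Category.assoc, ← U.map_comp, hr₂, U.map_comp, reassoc_of% hn₂, hl₂]
    have hgk : g₁ ≫ U.map k = g₂ ≫ U.map k := by
      rw [← e₁, ← e₂, Category.assoc, Category.assoc, ← U.map_comp, ← U.map_comp, hk]
    obtain ⟨m, hm⟩ := Cofork.IsColimit.desc' (IsKernelPair.of_hasPullback π').toCoequalizer'
      (U.map k) hgk
    exact ⟨m, hm⟩

end Reflective

theorem regular_maltsev_stable_of_isSemiLocalization {X : Type u} [Category.{v} X] {C : Type u'}
    [Category.{v'} C] {U : X ⥤ C} (hC : IsExactCategory C) (hC' : IsMaltsevCategory C)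
    (hU : IsSemiLocalization U) :
    Regular X ∧ IsMaltsevCategory X ∧ HasStableCoequalizersOfEquivalenceRelations X := by
  obtain ⟨_, hU⟩ := hU
  have h := isMaltsevCategory_of_reflective U hC'
  have := h.hasFiniteLimits
  have hs := hU.hasStableCoequalizers hC
  exact ⟨hs.regular, h, hs⟩

theorem mainTheorem5 (X : Type u) [Category.{v} X] :
    List.TFAE
      [ Regular X ∧ IsMaltsevCategory X ∧ HasStableCoequalizersOfEquivalenceRelations X,
        ∃ (C : Type (max u v)) (_ : Category.{max u v} C) (U : X ⥤ C),
          IsExactCategory C ∧ IsMaltsevCategory C ∧ IsSemiLocalization U,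
        ∃ (C : Type (max u v)) (_ : Category.{max u v} C) (U : X ⥤ C),
          IsExactCategory C ∧ IsMaltsevCategory C ∧ IsSemiLocalizationWithRegularEpiUnits U,
        ∃ _ : Regular X, IsMaltsevCategory X ∧ IsSemiLocalization (ExReg.embedding X) ] ∧
    -- the implication from the second condition to the first, for `C` of arbitrary size
    (∀ (C : Type u') [Category.{v'} C] (U : X ⥤ C),
      IsExactCategory C → IsMaltsevCategory C → IsSemiLocalization U →
      Regular X ∧ IsMaltsevCategory X ∧ HasStableCoequalizersOfEquivalenceRelations X) ∧
    -- the exact completion of a regular Mal'tsev category is a Mal'tsev category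
    (∀ [Regular X], IsMaltsevCategory X → IsMaltsevCategory (ExReg X)) := by
  refine ⟨?_, fun C _ U => regular_maltsev_stable_of_isSemiLocalization,
    fun h => ExReg.isMaltsevCategory h⟩
  tfae_have 1 → 4 := fun ⟨h, h', hs⟩ => ⟨h, h', ExReg.isSemiLocalization_embedding hs⟩
  tfae_have 4 → 3 := by
    rintro ⟨_, h, hr, hU⟩
    -- Objects and morphisms of `ExReg X` both contain subobjects, which places them in the universe
    -- `max u v`.
    exact ⟨ExReg X, inferInstance, ExReg.embedding X, ExReg.isExactCategory,
      ExReg.isMaltsevCategory h, hr, hU, ExReg.isRegularEpi_unit⟩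
  tfae_have 3 → 2 := fun ⟨C, i, U, h, h', hr, hU, _⟩ => ⟨C, i, U, h, h', hr, hU⟩
  tfae_have 2 → 1 := fun ⟨_, _, _, h, h', hU⟩ =>
    regular_maltsev_stable_of_isSemiLocalization h h' hU
  tfae_finish
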